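/- **Setting.** Let $U,\bar U\subseteq\mathbb R^2$ be open and consider two smooth (pseudo-)Riemannian metrics, of arbitrary signature, $$\mathbf g=b_{ij}(t)\,dt^i dt^j+2f_{ik}(t)\,dt^i dz^k+h_{kl}(t)\,dz^k dz^l,\qquad \bar{\mathbf g}=\bar b_{mn}(\bar t)\,d\bar t^m d\bar t^n+2\bar f_{mr}(\bar t)\,d\bar t^m d\bar z^r+\bar h_{rs}(\bar t)\,d\bar z^r d\bar z^s$$ on $U\times\mathbb R^2$ and $\bar U\times\mathbb R^2$ (indices run over $1,2$; $b,h$ symmetric), with $\det(h_{kl})\neq0$ and $\det(\bar h_{kl})\ne 0$ everywhere. Assume that the Killing algebra of each metric is exactly the span of $\partial_{z^1},\partial_{z^2}$ (resp. $\partial_{\bar z^1},\partial_{\bar z^2}$), i.e. every Killing field on a connected open set is a constant linear combination of these. For $\mathbf g$ put $f^k_j=f_{js}h^{sk}$, $\tilde g_{ij}=b_{ij}-f_{ik}f_{jl}h^{kl}$, $\sigma=d(\det h)/\det h$, $\rho=\sigma^2$, $\chi=(dh_{11}dh_{22}-dh_{12}^2)/\det h$, $\gamma=\chi-\frac14\rho$,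 and $C_\mu=\mu_{ij}\tilde g^{ij}$, $Q_\mu=\det\mu/\det\tilde g$ for a symmetric form $\mu$. Define $$\mathcal C^k=\frac{\partial_{t^2}f^k_1-\partial_{t^1}f^k_2}{\sqrt{|\det\tilde g|}},\quad (\mathcal C^\perp)^1=\frac{h_{s2}\mathcal C^s}{\sqrt{|\det h|}},\quad(\mathcal C^\perp)^2=\frac{-h_{s1}\mathcal C^s}{\sqrt{|\det h|}},\quad \ell_{\mathcal C}=h_{kl}\mathcal C^k\mathcal C^l,$$ $$\mathcal H^i=-\tfrac12\tilde g^{is}\sigma_s,\quad(\mathcal H^\perp)^1=-\frac{\sigma_2}{2\sqrt{|\det\tilde g|}},\quad(\mathcal H^\perp)^2=\frac{\sigma_1}{2\sqrt{|\det\tilde g|}},$$ $$\Theta_{\mathrm I}=\frac1{\sqrt{|\det h|\,|\det\tilde g|}}\begin{vmatrix}h_{11,1}&h_{12,1}&h_{22,1}\\h_{11,2}&h_{12,2}&h_{22,2}\\(\mathcal C^2)^2&-\mathcal C^1\mathcal C^2&(\mathcal C^1)^2\end{vmatrix},$$ and $(I_1,\dots,I_6)=(C_\rho,C_\chi,Q_\chi,Q_\gamma,\ell_{\mathcal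 C},\Theta_{\mathrm I}^2)$, all functions of $t\in U$; the same objects of $\bar{\mathbf g}$, functions of $\bar t\in\bar U$, carry a bar. Two functions of $t$ are *functionally independent* on a region if their Jacobian determinant vanishes nowhere there. For vectors $X,Y\in\mathbb R^2$ write $(X\mid Y)$ for the matrix with columns $X,Y$. The metrics are *equivalent* if there is an isometry, i.e. a smooth diffeomorphism $\Phi$ with $\Phi^*\bar{\mathbf g}=\mathbf g$, from some nonempty open subset of $U\times\mathbb R^2$ onto an open subset of $\bar U\times\mathbb R^2$; they are equivalent at $(p,\bar p)$ if moreover $p$ is in the domain of $\Phi$ and $\Phi(p)=\bar p$. **Theorem.** Assume $\ell_{\mathcal C}C_\rho\neq0$ everywhere on $U$, $\bar\ell_{\bar{\mathcal C}}\bar C_{\bar\rho}\ne0$ everywhere on $\bar U$, and that some two of the invariants $I_1,\dots,I_6$ of $\mathbf g$ are functionally independent on $U$. Then $\mathbf g$ and $\bar{\mathbf g}$ are equivalent if and only if there exist a nonempty open $V\subseteq U$ and a coordinate transformation $$P:\quad\bar t^i=\phi^i(t^1,t^2),\qquad\bar z^i=\alpha^i_jz^j+\psi^i(t^1,t^2),\qquad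 t\in V,\ z\in\mathbb R^2,\ (\alpha^i_j)\in\mathrm{GL}(2,\mathbb R),$$ with $\phi:V\to\bar U$ smooth and injective, $J_\phi=\det(\partial\phi^i/\partial t^j)\ne0$, and $\psi$ smooth, such that, with $\epsilon_1=\operatorname{sgn}J_\phi$, $\epsilon_2=\operatorname{sgn}\det\alpha$, unbarred objects evaluated at $t\in V$ and barred ones at $\bar t=\phi(t)$: (i) for some $a,b\in\{1,\dots,6\}$, $I_a,I_b$ are functionally independent on $V$, $\bar I_a,\bar I_b$ are functionally independent on $\phi(V)$, and $\bar t=\phi(t)$ is implicitly defined by $I_a(t)=\bar I_a(\bar t)$, $I_b(t)=\bar I_b(\bar t)$ (for each $t_0\in V$, these equations are equivalent to $\bar t=\phi(t)$ for $(t,\bar t)$ near $(t_0,\phi(t_0))$); (ii) $\epsilon_1\,(\bar{\mathcal C}\mid\epsilon_2\bar{\mathcal C}^\perp)\,(\mathcal C\mid\mathcal C^\perp)^{-1}$ is a constant matrix, equal to $\alpha=(\alpha^i_j)$; (iii) $\left(\partial\phi^i/\partial t^j\right)=(\bar{\mathcal H}\mid\epsilon_1\bar{\mathcal H}^\perp)\,(\mathcal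 H\mid\mathcal H^\perp)^{-1}$; (iv) the first-order system $\left(\partial\psi^i/\partial t^j\right)=\alpha\,(f^i_j)-(\bar f^i_j)\,(\bar{\mathcal H}\mid\epsilon_1\bar{\mathcal H}^\perp)\,(\mathcal H\mid\mathcal H^\perp)^{-1}$ is integrable (its right-hand side $R^i_j$ satisfies $\partial_{t^2}R^i_1=\partial_{t^1}R^i_2$) and is satisfied by $\psi$; (v) the transformation rules hold: $$b_{ij}=\bar b_{mn}\frac{\partial\phi^m}{\partial t^i}\frac{\partial\phi^n}{\partial t^j}+\bar f_{mr}\Big(\frac{\partial\phi^m}{\partial t^i}\frac{\partial\psi^r}{\partial t^j}+\frac{\partial\phi^m}{\partial t^j}\frac{\partial\psi^r}{\partial t^i}\Big)+\bar h_{rs}\frac{\partial\psi^r}{\partial t^i}\frac{\partial\psi^s}{\partial t^j},$$ $$f_{ik}=\bar f_{mr}\alpha^r_k\frac{\partial\phi^m}{\partial t^i}+\bar h_{rs}\alpha^r_k\frac{\partial\psi^s}{\partial t^i},\qquad h_{kl}=\bar h_{rs}\alpha^r_k\alpha^s_l.$$ More precisely, for all $p\in U\times\mathbb R^2$ and $\bar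 p\in\bar U\times\mathbb R^2$ the metrics are equivalent at $(p,\bar p)$ if and only if there is such a $P$ defined at $p$ with $P(p)=\bar p$. -/

import Mathlib

open scoped ContDiff Topology

noncomputable section

/-- The coordinate plane; both `t = (t¹, t²)` and `z = (z¹, z²)` range over it. -/
abbrev Plane : Type := Fin 2 → ℝ

/-- Real `2 × 2` matrices. -/
abbrev Mat2 : Type := Matrix (Fin 2) (Fin 2) ℝ

/-- The partial derivative `∂F/∂tⁱ`. -/
def pd (i : Fin 2) (F : Plane → ℝ) (t : Plane) : ℝ :=
  fderiv ℝ F t (Pi.single i 1)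

/-- The Jacobian matrix of a map of the plane, row `i`, column `j` being `∂φⁱ/∂tʲ`. -/
def jac (φ : Plane → Plane) (t : Plane) : Mat2 :=
  Matrix.of fun i j => pd j (fun s => φ s i) t

/-- The matrix with columns `X` and `ε Y`. -/
def colMatrix (ε : ℝ) (X Y : Plane) : Mat2 :=
  !![X 0, ε * Y 0; X 1, ε * Y 1]

/-- Functional independence on a region of the plane: `dF ∧ dG` vanishes nowhere on it. -/
def FunctionallyIndependentOn (F G : Plane → ℝ) (V : Set Plane) : Prop :=
  ∀ t ∈ V, pd 0 F t * pd 1 G t - pd 1 F t * pd 0 G t ≠ 0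

/-- A (pseudo-)Riemannian metric
`b_{ij}(t) dtⁱ dtʲ + 2 f_{ik}(t) dtⁱ dzᵏ + h_{kl}(t) dzᵏ dzˡ` in adapted coordinates `(t, z)`,
`t ∈ U`, `z ∈ ℝ²`, of arbitrary signature and with non-null Killing leaves `t = const`. -/
structure AdaptedMetric where
  U : Set Plane
  isOpen_U : IsOpen U
  b : Plane → Mat2
  f : Plane → Mat2
  h : Plane → Mat2
  smooth_b : ∀ i j, ContDiffOn ℝ ∞ (fun t => b t i j) U
  smooth_f : ∀ i k, ContDiffOn ℝ ∞ (fun t => f t i k) U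
  smooth_h : ∀ k l, ContDiffOn ℝ ∞ (fun t => h t k l) U
  symm_b : ∀ t ∈ U, (b t).IsSymm
  symm_h : ∀ t ∈ U, (h t).IsSymm
  nondegenerate : ∀ t ∈ U, (Matrix.fromBlocks (b t) (f t) (f t).transpose (h t)).det ≠ 0
  leaves_nonnull : ∀ t ∈ U, (h t).det ≠ 0

namespace AdaptedMetric

variable (g : AdaptedMetric)

/-- The coordinate domain `U × ℝ²` of the metric. -/
def domain : Set (Plane × Plane) := {q | q.1 ∈ g.U}

/-- The value `g_q(v, w)` on tangent vectors `v = (dt, dz)`, `w` at the point `q = (t, z)`. -/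
def form (q v w : Plane × Plane) : ℝ :=
  (∑ i, ∑ j, g.b q.1 i j * v.1 i * w.1 j)
    + (∑ i, ∑ k, g.f q.1 i k * (v.1 i * w.2 k + w.1 i * v.2 k))
    + ∑ k, ∑ l, g.h q.1 k l * v.2 k * w.2 l

/-- `X` is a Killing field on `W`, i.e. the Lie derivative of `g` along `X` vanishes there. -/
def IsKillingOn (X : Plane × Plane → Plane × Plane) (W : Set (Plane × Plane)) : Prop :=
  ∀ q ∈ W, ∀ v w : Plane × Plane,
    fderiv ℝ (fun r => g.form r v w) q (X q)
      + g.form q (fderiv ℝ X q v) w + g.form q v (fderiv ℝ X q w) = 0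

/-- The Killing algebra of `g` is exactly the span of `∂/∂z¹`, `∂/∂z²`: every Killing field
on a connected open set of the domain is a constant combination of these two
(that these two are Killing fields is automatic). -/
def KillingAlgebraIsG2 : Prop :=
  ∀ W : Set (Plane × Plane), IsOpen W → IsPreconnected W → W ⊆ g.domain →
    ∀ X : Plane × Plane → Plane × Plane, ContDiffOn ℝ ∞ X W → g.IsKillingOn X W →
      ∃ c : Plane, ∀ q ∈ W, X q = (0, c)

/-- `f_j^k = f_{js} h^{sk}`, as the matrix with row index `k` and column index `j`. -/
def fUp (t : Plane) : Mat2 :=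
  Matrix.of fun k j => ∑ s, g.f t j s * (g.h t)⁻¹ s k

/-- The orbit metric `g̃_{ij} = b_{ij} - f_{ik} f_{jl} h^{kl}`. -/
def orbit (t : Plane) : Mat2 :=
  Matrix.of fun i j => g.b t i j - ∑ k, ∑ l, g.f t i k * g.f t j l * (g.h t)⁻¹ k l

/-- `det h`. -/
def detH (t : Plane) : ℝ := (g.h t).det

/-- `√|det g̃|`. -/
def sqrtOrbit (t : Plane) : ℝ := √|(g.orbit t).det|

/-- The partial derivative `h_{kl,i}`. -/
def dh (k l i : Fin 2) (t : Plane) : ℝ := pd i (fun s => g.h s k l) t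

/-- The 1-form `σ = d(det h) / det h`. -/
def sigma (t : Plane) : Plane := fun i => pd i g.detH t / g.detH t

/-- `ρ = σ²`. -/
def rho (t : Plane) : Mat2 := Matrix.of fun i j => g.sigma t i * g.sigma t j

/-- `χ = (dh₁₁ dh₂₂ - dh₁₂ dh₁₂) / det h`, a symmetric product of 1-forms. -/
def chi (t : Plane) : Mat2 :=
  Matrix.of fun i j =>
    1 / (2 * g.detH t) *
      ((g.dh 0 0 i t * g.dh 1 1 j t - g.dh 0 1 j t * g.dh 1 0 i t)
        + (g.dh 0 0 j t * g.dh 1 1 i t - g.dh 0 1 i t * g.dh 1 0 j t))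

/-- `γ = χ - ρ / 4`. -/
def gamma (t : Plane) : Mat2 := g.chi t - (1 / 4 : ℝ) • g.rho t

/-- `C_μ = μ_{ij} g̃^{ij}`. -/
def traceInv (μ : Plane → Mat2) (t : Plane) : ℝ :=
  ∑ i, ∑ j, μ t i j * (g.orbit t)⁻¹ i j

/-- `Q_μ = det μ / det g̃`. -/
def detInv (μ : Plane → Mat2) (t : Plane) : ℝ := (μ t).det / (g.orbit t).det

/-- `C_ρ`. -/
def Crho : Plane → ℝ := g.traceInv g.rho

/-- The components `𝒞ᵏ` of the curvature vector field
`𝒞 = ver [hor ∂_{t¹}, hor ∂_{t²}] / √|det g̃|`. -/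
def curv (t : Plane) : Plane := fun k =>
  (pd 1 (fun s => g.fUp s k 0) t - pd 0 (fun s => g.fUp s k 1) t) / g.sqrtOrbit t

/-- The components of `𝒞^⊥`, the orthogonal complement of `𝒞` in the Killing leaves. -/
def curvPerp (t : Plane) : Plane :=
  ![(∑ s, g.h t s 1 * g.curv t s) / √|g.detH t|,
    -(∑ s, g.h t s 0 * g.curv t s) / √|g.detH t|]

/-- `ℓ_𝒞 = g(𝒞, 𝒞)`. -/
def ellC (t : Plane) : ℝ := ∑ k, ∑ l, g.h t k l * g.curv t k * g.curv t l

/-- The components `ℋⁱ` of the mean curvature vector field of the leaves with respect to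
the horizontal lifts of `∂/∂tⁱ`. -/
def mean (t : Plane) : Plane := fun i =>
  -(1 / 2) * ∑ s, (g.orbit t)⁻¹ i s * (pd s g.detH t / g.detH t)

/-- The components of `ℋ^⊥` with respect to the horizontal lifts of `∂/∂tⁱ`. -/
def meanPerp (t : Plane) : Plane :=
  ![-(1 / 2) * (pd 1 g.detH t / (g.detH t * g.sqrtOrbit t)),
    (1 / 2) * (pd 0 g.detH t / (g.detH t * g.sqrtOrbit t))]

/-- The semi-invariant `Θ_I`. -/
def thetaI (t : Plane) : ℝ :=
  1 / (√|g.detH t| * g.sqrtOrbit t) *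
    Matrix.det !![g.dh 0 0 0 t, g.dh 0 1 0 t, g.dh 1 1 0 t;
                  g.dh 0 0 1 t, g.dh 0 1 1 t, g.dh 1 1 1 t;
                  g.curv t 1 ^ 2, -(g.curv t 0 * g.curv t 1), g.curv t 0 ^ 2]

/-- The six fundamental first-order invariants
`C_ρ, C_χ, Q_χ, Q_γ, ℓ_𝒞, (Θ_I)²` evaluated on the metric. -/
def inv : Fin 6 → Plane → ℝ :=
  ![g.Crho, g.traceInv g.chi, g.detInv g.chi, g.detInv g.gamma, g.ellC,
    fun t => g.thetaI t ^ 2]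

end AdaptedMetric

/-- The germs of `g` at `p` and of `g'` at `p'` are equivalent: there is a smooth
diffeomorphism (an arbitrary one, not required to respect the adapted coordinates) between
neighbourhoods of `p` and `p'` that maps `p` to `p'` and pulls `g'` back to `g`. -/
def EquivalentAt (g g' : AdaptedMetric) (p p' : Plane × Plane) : Prop :=
  ∃ Φ : OpenPartialHomeomorph (Plane × Plane) (Plane × Plane),
    p ∈ Φ.source ∧ Φ p = p' ∧ Φ.source ⊆ g.domain ∧ Φ.target ⊆ g'.domain ∧
    ContDiffOn ℝ ∞ Φ Φ.source ∧ ContDiffOn ℝ ∞ Φ.symm Φ.target ∧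
    ∀ q ∈ Φ.source, ∀ v w : Plane × Plane,
      g'.form (Φ q) (fderiv ℝ Φ q v) (fderiv ℝ Φ q w) = g.form q v w

/-- The metrics are (locally) equivalent. -/
def Equivalent (g g' : AdaptedMetric) : Prop :=
  ∃ p ∈ g.domain, ∃ p' ∈ g'.domain, EquivalentAt g g' p p'

/-- An adapted coordinate transformation
`t̄ⁱ = φⁱ(t)`, `z̄ⁱ = α^i_j zʲ + ψⁱ(t)`, defined for `t` in an open set `V` and `z ∈ ℝ²`. -/
structure AdaptedTransformation (g g' : AdaptedMetric) where
  V : Set Plane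
  isOpen_V : IsOpen V
  V_subset : V ⊆ g.U
  φ : Plane → Plane
  ψ : Plane → Plane
  α : GL (Fin 2) ℝ
  smooth_φ : ContDiffOn ℝ ∞ φ V
  smooth_ψ : ContDiffOn ℝ ∞ ψ V
  mapsTo : Set.MapsTo φ V g'.U
  injOn : Set.InjOn φ V
  jacobian_ne : ∀ t ∈ V, (jac φ t).det ≠ 0

namespace AdaptedTransformation

variable {g g' : AdaptedMetric} (P : AdaptedTransformation g g')

/-- The transformation as a map of points `(t, z)`. -/
def toMap (q : Plane × Plane) : Plane × Plane :=
  (P.φ q.1, P.α.val.mulVec q.2 + P.ψ q.1)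

/-- `ε₁ = sgn J_φ`. -/
def ε₁ (t : Plane) : ℝ := Real.sign (jac P.φ t).det

/-- `ε₂ = sgn det α`. -/
def ε₂ : ℝ := Real.sign P.α.val.det

/-- The product of the `ℋ`-frame matrix of `g'` at `φ(t)` with the inverse one of `g` at `t`. -/
def meanQuotient (t : Plane) : Mat2 :=
  colMatrix (P.ε₁ t) (g'.mean (P.φ t)) (g'.meanPerp (P.φ t))
    * (colMatrix 1 (g.mean t) (g.meanPerp t))⁻¹

/-- (i) For some `a, b` the invariants `I_a, I_b` are functionally independent for both
metrics, and near every point `(t₀, φ(t₀))` the graph of `φ` is the solution set of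
`I_a[g](t) = I_a[g'](t̄)`, `I_b[g](t) = I_b[g'](t̄)`. -/
def CondI : Prop :=
  ∃ a b : Fin 6,
    FunctionallyIndependentOn (g.inv a) (g.inv b) P.V ∧
    FunctionallyIndependentOn (g'.inv a) (g'.inv b) (P.φ '' P.V) ∧
    ∀ t₀ ∈ P.V, ∀ᶠ x : Plane × Plane in 𝓝 (t₀, P.φ t₀),
      (g.inv a x.1 = g'.inv a x.2 ∧ g.inv b x.1 = g'.inv b x.2) ↔ x.2 = P.φ x.1

/-- (ii) The matrix built from the `𝒞`-frames is constant and equal to `α`. -/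
def CondII : Prop :=
  ∀ t ∈ P.V,
    P.ε₁ t • (colMatrix P.ε₂ (g'.curv (P.φ t)) (g'.curvPerp (P.φ t))
      * (colMatrix 1 (g.curv t) (g.curvPerp t))⁻¹) = P.α.val

/-- (iii) The Jacobian matrix of `φ` matches the `ℋ`-frames. -/
def CondIII : Prop :=
  ∀ t ∈ P.V, jac P.φ t = P.meanQuotient t

/-- The right-hand side of the first-order system for `ψ`. -/
def psiRHS (t : Plane) : Mat2 :=
  P.α.val * g.fUp t - g'.fUp (P.φ t) * P.meanQuotient t

/-- (iv) The system `∂ψⁱ/∂tʲ = psiRHS i j` is integrable (its compatibility conditions hold)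
and `ψ` solves it. -/
def CondIV : Prop :=
  (∀ t ∈ P.V, ∀ i, pd 1 (fun s => P.psiRHS s i 0) t = pd 0 (fun s => P.psiRHS s i 1) t) ∧
  ∀ t ∈ P.V, jac P.ψ t = P.psiRHS t

/-- (v) The transformation rules of the metric coefficients. -/
def CondV : Prop :=
  ∀ t ∈ P.V,
    (∀ i j, g.b t i j =
      (∑ m, ∑ n, g'.b (P.φ t) m n * jac P.φ t m i * jac P.φ t n j)
        + (∑ m, ∑ r, g'.f (P.φ t) m r *
            (jac P.φ t m i * jac P.ψ t r j + jac P.φ t m j * jac P.ψ t r i))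
        + ∑ r, ∑ s, g'.h (P.φ t) r s * jac P.ψ t r i * jac P.ψ t s j) ∧
    (∀ i k, g.f t i k =
      (∑ m, ∑ r, g'.f (P.φ t) m r * P.α.val r k * jac P.φ t m i)
        + ∑ r, ∑ s, g'.h (P.φ t) r s * P.α.val r k * jac P.ψ t s i) ∧
    (∀ k l, g.h t k l = ∑ r, ∑ s, g'.h (P.φ t) r s * P.α.val r k * P.α.val s l)

/-- All five conditions. -/
def Conditions : Prop :=
  P.CondI ∧ P.CondII ∧ P.CondIII ∧ P.CondIV ∧ P.CondV

end AdaptedTransformation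

end

/-!
An isometry `Φ` pulls Killing fields back to Killing fields, so the constant fields `(0, c)` come
back as constant fields `(0, d)`. Hence `DΦ` restricted to the leaves `t = const` is a constant
linear map `α`, which forces `Φ(t, z) = (φ(t), α z + ψ(t))` locally, and for a map of this form
being an isometry is exactly the transformation rule (v).

The rule (v) says that `h` transforms by `α`, the orbit metric `g̃` by the Jacobian `J` of `φ`, and
`f_j^k` as the components of a connection whose gauge term is `dψ`; its curvature is therefore
gauge invariant. So the scalar invariants of corresponding points agree, while
`α 𝒞 = ε₁ 𝒞̄`, `α 𝒞^⊥ = ε₁ ε₂ 𝒞̄^⊥`, `J ℋ = ℋ̄` and `J ℋ^⊥ = ε₁ ℋ̄^⊥`, the signs coming from the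
absolute values under the square roots. As `ℓ_𝒞 ≠ 0` and `C_ρ ≠ 0` make `(𝒞 ∣ 𝒞^⊥)` and
`(ℋ ∣ ℋ^⊥)` invertible, (i)-(iv) follow from (v).
-/

noncomputable section

open scoped Matrix

/-! ### Calculus in the plane -/

section Calculus

variable {F G : Plane → ℝ} {φ : Plane → Plane} {t : Plane}

theorem pd_add (hF : DifferentiableAt ℝ F t) (hG : DifferentiableAt ℝ G t) (i : Fin 2) :
    pd i (fun s => F s + G s) t = pd i F t + pd i G t := by
  rw [pd, fderiv_fun_add hF hG]
  rfl

theorem pd_mul (hF : DifferentiableAt ℝ F t) (hG : DifferentiableAt ℝ G t) (i : Fin 2) :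
    pd i (fun s => F s * G s) t = F t * pd i G t + G t * pd i F t := by
  rw [pd, fderiv_fun_mul hF hG]
  rfl

theorem pd_sum {ι : Type*} {I : Finset ι} {A : ι → Plane → ℝ}
    (hA : ∀ k ∈ I, DifferentiableAt ℝ (A k) t) (i : Fin 2) :
    pd i (fun s => ∑ k ∈ I, A k s) t = ∑ k ∈ I, pd i (A k) t := by
  rw [pd, fderiv_fun_sum hA, sum_apply]
  rfl

theorem pd_const_mul (hF : DifferentiableAt ℝ F t) (c : ℝ) (i : Fin 2) :
    pd i (fun s => c * F s) t = c * pd i F t := by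
  rw [pd, fderiv_const_mul hF]
  rfl

theorem pd_sum_const_mul {ι : Type*} {I : Finset ι} {A : ι → Plane → ℝ}
    (hA : ∀ k ∈ I, DifferentiableAt ℝ (A k) t) (c : ι → ℝ) (i : Fin 2) :
    pd i (fun s => ∑ k ∈ I, c k * A k s) t = ∑ k ∈ I, c k * pd i (A k) t := by
  rw [pd_sum fun k hk => (hA k hk).const_mul (c k)]
  exact Finset.sum_congr rfl fun k hk => pd_const_mul (hA k hk) (c k) i

theorem pd_congr (h : F =ᶠ[𝓝 t] G) (i : Fin 2) : pd i F t = pd i G t := by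
  rw [pd, pd, h.fderiv_eq]

theorem fderiv_apply_eq_sum_pd (v : Plane) : fderiv ℝ F t v = ∑ m, pd m F t * v m := by
  conv_lhs => rw [pi_eq_sum_univ' v]
  simp only [map_sum, map_smul, smul_eq_mul, mul_comm, pd]

theorem fderiv_apply_eq_jac_mulVec (hφ : DifferentiableAt ℝ φ t) (v : Plane) :
    fderiv ℝ φ t v = jac φ t *ᵥ v := by
  ext i
  have component : (fderiv ℝ φ t v) i = fderiv ℝ (fun s => φ s i) t v := by
    rw [fderiv_apply hφ i]
    rfl
  rw [component, fderiv_apply_eq_sum_pd]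
  rfl

theorem pd_comp (hF : DifferentiableAt ℝ F (φ t)) (hφ : DifferentiableAt ℝ φ t) (i : Fin 2) :
    pd i (fun s => F (φ s)) t = ∑ m, pd m F (φ t) * jac φ t m i := by
  have chain_rule : fderiv ℝ (fun s => F (φ s)) t = (fderiv ℝ F (φ t)).comp (fderiv ℝ φ t) :=
    fderiv_comp t hF hφ
  rw [pd, chain_rule, ContinuousLinearMap.comp_apply, fderiv_apply_eq_jac_mulVec hφ,
    fderiv_apply_eq_sum_pd]
  simp only [Matrix.mulVec_single_one, Matrix.col_apply]

theorem jac_comp {Ψ : Plane → Plane} (hΨ : DifferentiableAt ℝ Ψ (φ t))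
    (hφ : DifferentiableAt ℝ φ t) :
    jac (fun s => Ψ (φ s)) t = jac Ψ (φ t) * jac φ t := by
  ext i j
  exact pd_comp (differentiableAt_pi.1 hΨ i) hφ j

theorem jac_congr {Ψ : Plane → Plane} (h : φ =ᶠ[𝓝 t] Ψ) : jac φ t = jac Ψ t := by
  ext i j
  exact pd_congr (h.fun_comp (· i)) j

theorem pd_comm (hF : ContDiffAt ℝ 2 F t) (i j : Fin 2) :
    pd i (pd j F) t = pd j (pd i F) t := by
  have hF' : DifferentiableAt ℝ (fderiv ℝ F) t :=
    (hF.fderiv_right (m := 1) le_rfl).differentiableAt one_ne_zero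
  have pd_pd (a b : Fin 2) :
      pd a (pd b F) t = fderiv ℝ (fderiv ℝ F) t (Pi.single a 1) (Pi.single b 1) := by
    change fderiv ℝ (fun s => fderiv ℝ F s (Pi.single b 1)) t (Pi.single a 1) = _
    rw [fderiv_clm_apply hF' (differentiableAt_const _)]
    simp
  rw [pd_pd, pd_pd]
  exact hF.isSymmSndFDerivAt (by simp) _ _

theorem differentiableAt_pd (hF : ContDiffAt ℝ 2 F t) (i : Fin 2) :
    DifferentiableAt ℝ (pd i F) t :=
  ((hF.fderiv_right (m := 1) le_rfl).differentiableAt one_ne_zero).clm_apply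
    (differentiableAt_const _)

theorem contDiffOn_pd {V : Set Plane} (hV : IsOpen V) (hF : ContDiffOn ℝ ∞ F V) (i : Fin 2) :
    ContDiffOn ℝ ∞ (pd i F) V :=
  (hF.fderiv_of_isOpen hV (by simp)).clm_apply contDiffOn_const

theorem functionallyIndependentOn_iff_det_jac_ne_zero {V : Set Plane} :
    FunctionallyIndependentOn F G V ↔ ∀ t ∈ V, (jac (fun s => ![F s, G s]) t).det ≠ 0 := by
  simp only [FunctionallyIndependentOn, Matrix.det_fin_two, jac, Matrix.of_apply,
    Matrix.cons_val_zero, Matrix.cons_val_one]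

/-- The curl of the `1`-form `u₀ dt⁰ + u₁ dt¹`, with the sign used in the definition of `𝒞`:
`du = -(curl u) dt⁰ ∧ dt¹`. -/
def curl (u : Plane → Plane) (t : Plane) : ℝ :=
  pd 1 (fun s => u s 0) t - pd 0 (fun s => u s 1) t

variable {u w : Plane → Plane}

theorem curl_congr (h : u =ᶠ[𝓝 t] w) : curl u t = curl w t :=
  congrArg₂ (· - ·) (pd_congr (h.fun_comp (· 0)) 1) (pd_congr (h.fun_comp (· 1)) 0)

theorem curl_add (hu : DifferentiableAt ℝ u t) (hw : DifferentiableAt ℝ w t) :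
    curl (fun s => u s + w s) t = curl u t + curl w t := by
  rw [differentiableAt_pi] at hu hw
  simp only [curl, Pi.add_apply, pd_add (hu _) (hw _)]
  ring

theorem curl_vecMul {A : Plane → Mat2} (hA : ∀ i j, DifferentiableAt ℝ (fun s => A s i j) t)
    (c : Plane) : curl (fun s => c ᵥ* A s) t = c ⬝ᵥ fun i => curl (fun s => A s i) t := by
  have pd_vecMul (i j : Fin 2) :
      pd i (fun s => (c ᵥ* A s) j) t = ∑ k, c k * pd i (fun s => A s k j) t :=
    pd_sum_const_mul (I := Finset.univ) (fun k _ => hA k j) c i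
  simp only [curl, pd_vecMul, dotProduct, mul_sub, Finset.sum_sub_distrib]

theorem curl_gradient (hF : ContDiffAt ℝ 2 F t) : curl (fun s i => pd i F s) t = 0 :=
  sub_eq_zero.2 (pd_comm hF 1 0)

theorem differentiableAt_pullback (hu : DifferentiableAt ℝ u (φ t)) (hφ : ContDiffAt ℝ 2 φ t) :
    DifferentiableAt ℝ (fun s => u (φ s) ᵥ* jac φ s) t := by
  rw [differentiableAt_pi] at hu ⊢
  exact fun j => DifferentiableAt.fun_sum (u := Finset.univ) fun m _ =>
    ((hu m).comp t (hφ.differentiableAt two_ne_zero)).mul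
      (differentiableAt_pd (contDiffAt_pi.1 hφ m) j)

theorem curl_pullback (hu : DifferentiableAt ℝ u (φ t)) (hφ : ContDiffAt ℝ 2 φ t) :
    curl (fun s => u (φ s) ᵥ* jac φ s) t = (jac φ t).det * curl u (φ t) := by
  have hφ' : DifferentiableAt ℝ φ t := hφ.differentiableAt two_ne_zero
  have hu' (m : Fin 2) : DifferentiableAt ℝ (fun s => u (φ s) m) t :=
    (differentiableAt_pi.1 hu m).comp t hφ'
  have hφ_i (m : Fin 2) : ContDiffAt ℝ 2 (fun s => φ s m) t := contDiffAt_pi.1 hφ m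
  have pd_pullback (i j : Fin 2) : pd i (fun s => (u (φ s) ᵥ* jac φ s) j) t =
      ∑ m, (u (φ t) m * pd i (pd j fun s => φ s m) t +
        jac φ t m j * ∑ n, pd n (fun s => u s m) (φ t) * jac φ t n i) := by
    refine (pd_sum (I := Finset.univ) (A := fun m s => u (φ s) m * jac φ s m j)
      (fun m _ => (hu' m).mul (differentiableAt_pd (hφ_i m) j)) i).trans
      (Finset.sum_congr rfl fun m _ => ?_)
    rw [← pd_comp (differentiableAt_pi.1 hu m) hφ']
    exact pd_mul (hu' m) (differentiableAt_pd (hφ_i m) j) i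
  simp only [curl, pd_pullback, pd_comm (hφ_i _) 1 0, Matrix.det_fin_two, Fin.sum_univ_two]
  ring

end Calculus

section InverseFunction

variable {𝕜 E : Type*} [RCLike 𝕜] [NormedAddCommGroup E] [NormedSpace 𝕜 E]
  [FiniteDimensional 𝕜 E] {n : WithTop ℕ∞}

theorem exists_continuousLinearEquiv_eq_of_injective {L : E →L[𝕜] E} (hL : Function.Injective L) :
    ∃ e : E ≃L[𝕜] E, (e : E →L[𝕜] E) = L :=
  ⟨(LinearEquiv.ofInjectiveEndo L.toLinearMap hL).toContinuousLinearEquiv, by ext; rfl⟩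

theorem exists_openPartialHomeomorph_of_injective_fderiv {f : E → E} {a : E}
    (hf : ContDiffAt 𝕜 n f a) (hn : n ≠ 0) (hinj : Function.Injective (fderiv 𝕜 f a)) :
    ∃ e : OpenPartialHomeomorph E E, a ∈ e.source ∧ ⇑e = f := by
  have := FiniteDimensional.complete 𝕜 E
  obtain ⟨L, hL⟩ := exists_continuousLinearEquiv_eq_of_injective hinj
  have hf' : HasFDerivAt f (L : E →L[𝕜] E) a := by
    rw [hL]
    exact (hf.differentiableAt hn).hasFDerivAt
  exact ⟨hf.toOpenPartialHomeomorph f hf' hn, hf.mem_toOpenPartialHomeomorph_source hf' hn, rfl⟩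

theorem exists_mem_nhds_injOn_of_injective_fderiv {f : E → E} {a : E}
    (hf : ContDiffAt 𝕜 n f a) (hn : n ≠ 0) (hinj : Function.Injective (fderiv 𝕜 f a)) :
    ∃ N ∈ 𝓝 a, N.InjOn f := by
  obtain ⟨e, ha, rfl⟩ := exists_openPartialHomeomorph_of_injective_fderiv hf hn hinj
  exact ⟨e.source, e.open_source.mem_nhds ha, e.injOn⟩

theorem contDiffOn_symm_of_injective_fderiv {e : OpenPartialHomeomorph E E}
    (he : ContDiffOn 𝕜 n e e.source) (hn : n ≠ 0)
    (hinj : ∀ x ∈ e.source, Function.Injective (fderiv 𝕜 e x)) :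
    ContDiffOn 𝕜 n e.symm e.target := by
  have := FiniteDimensional.complete 𝕜 E
  intro y hy
  have hx : e.symm y ∈ e.source := e.map_target hy
  have he_at : ContDiffAt 𝕜 n e (e.symm y) := he.contDiffAt (e.open_source.mem_nhds hx)
  obtain ⟨L, hL⟩ := exists_continuousLinearEquiv_eq_of_injective (hinj _ hx)
  refine (e.contDiffAt_symm hy (f₀' := L) ?_ he_at).contDiffWithinAt
  rw [hL]
  exact (he_at.differentiableAt hn).hasFDerivAt

theorem fderiv_symm_fderiv {𝕜 E F : Type*} [NontriviallyNormedField 𝕜] [NormedAddCommGroup E]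
    [NormedSpace 𝕜 E] [NormedAddCommGroup F] [NormedSpace 𝕜 F] {e : OpenPartialHomeomorph E F}
    {x : E} (hx : x ∈ e.source) (he : DifferentiableAt 𝕜 e x)
    (he_symm : DifferentiableAt 𝕜 e.symm (e x)) (v : E) :
    fderiv 𝕜 e.symm (e x) (fderiv 𝕜 e x v) = v := by
  have symm_comp : e.symm ∘ e =ᶠ[𝓝 x] id := e.eventually_left_inverse hx
  rw [← ContinuousLinearMap.comp_apply, ← fderiv_comp x he_symm he, symm_comp.fderiv_eq, fderiv_id,
    ContinuousLinearMap.id_apply]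

theorem fderiv_fderiv_symm {𝕜 E F : Type*} [NontriviallyNormedField 𝕜] [NormedAddCommGroup E]
    [NormedSpace 𝕜 E] [NormedAddCommGroup F] [NormedSpace 𝕜 F] {e : OpenPartialHomeomorph E F}
    {x : E} (hx : x ∈ e.source) (he : DifferentiableAt 𝕜 e x)
    (he_symm : DifferentiableAt 𝕜 e.symm (e x)) (v : F) :
    fderiv 𝕜 e x (fderiv 𝕜 e.symm (e x) v) = v := by
  simpa only [e.symm_symm, e.left_inv hx] using
    fderiv_symm_fderiv (e := e.symm) (e.map_source hx) he_symm
      (by rwa [e.symm_symm, e.left_inv hx]) v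

theorem injective_fderiv_iff_isUnit_det_jac {φ : Plane → Plane} {t : Plane}
    (hφ : DifferentiableAt ℝ φ t) :
    Function.Injective (fderiv ℝ φ t) ↔ IsUnit (jac φ t).det := by
  have fderiv_eq : ⇑(fderiv ℝ φ t) = (jac φ t).mulVec := funext (fderiv_apply_eq_jac_mulVec hφ)
  rw [fderiv_eq, Matrix.mulVec_injective_iff_isUnit, Matrix.isUnit_iff_isUnit_det]

end InverseFunction

/-! ### Congruences of matrices -/

section MatrixAlgebra

variable {n : Type*} [Fintype n] [DecidableEq n] {R : Type*} [CommRing R]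

theorem mul_inv_transpose_mul_mul_mul_transpose {J : Matrix n n R} (hJ : IsUnit J.det)
    (G : Matrix n n R) : J * (Jᵀ * G * J)⁻¹ * Jᵀ = G⁻¹ := by
  have hJt : IsUnit Jᵀ.det := by rwa [Matrix.det_transpose]
  rw [Matrix.mul_inv_rev, Matrix.mul_inv_rev, Matrix.mul_nonsing_inv_cancel_left _ _ hJ,
    Matrix.nonsing_inv_mul_cancel_right _ _ hJt]

theorem det_transpose_mul_mul (A M : Matrix n n R) : (Aᵀ * M * A).det = A.det ^ 2 * M.det := by
  rw [Matrix.det_mul, Matrix.det_mul, Matrix.det_transpose]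
  ring

theorem trace_mul_adjugate_transpose_mul_mul (A X Y : Matrix n n R) :
    (Aᵀ * X * A * (Aᵀ * Y * A).adjugate).trace = A.det ^ 2 * (X * Y.adjugate).trace := by
  calc (Aᵀ * X * A * (Aᵀ * Y * A).adjugate).trace
      = (Aᵀ * (X * (A * A.adjugate) * Y.adjugate * Aᵀ.adjugate)).trace := by
        simp only [Matrix.adjugate_mul_distrib, Matrix.mul_assoc]
    _ = (X * (A * A.adjugate) * Y.adjugate * (Aᵀ.adjugate * Aᵀ)).trace := by
        rw [Matrix.trace_mul_comm]
        simp only [Matrix.mul_assoc]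
    _ = A.det ^ 2 * (X * Y.adjugate).trace := by
        rw [Matrix.mul_adjugate, Matrix.adjugate_mul, Matrix.det_transpose]
        simp only [mul_smul_one, Matrix.smul_mul, Matrix.trace_smul, smul_eq_mul]
        ring

theorem adjugate_sum_smul_fin_two {ι : Type*} (I : Finset ι) (c : ι → R)
    (X : ι → Matrix (Fin 2) (Fin 2) R) :
    (∑ i ∈ I, c i • X i).adjugate = ∑ i ∈ I, c i • (X i).adjugate := by
  ext i j
  fin_cases i <;> fin_cases j <;>
    simp [Matrix.adjugate_fin_two, Matrix.sum_apply]

/-- The matrix of the standard area form of the plane; it serves both as the form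
and as rotation by a right angle. -/
def areaForm (R : Type*) [CommRing R] : Matrix (Fin 2) (Fin 2) R := !![0, 1; -1, 0]

theorem mul_areaForm_mul_transpose (A : Matrix (Fin 2) (Fin 2) R) :
    A * areaForm R * Aᵀ = A.det • areaForm R := by
  ext i j
  fin_cases i <;> fin_cases j <;>
    simp only [areaForm, Matrix.mul_apply, Fin.sum_univ_two, Matrix.det_fin_two,
      Matrix.transpose_apply, Matrix.smul_apply, smul_eq_mul,
      Fin.zero_eta, Fin.mk_one, Matrix.of_apply, Matrix.cons_val] <;>
    ring

theorem transpose_mul_areaForm_mul (A : Matrix (Fin 2) (Fin 2) R) :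
    Aᵀ * areaForm R * A = A.det • areaForm R := by
  simpa only [Matrix.transpose_transpose, Matrix.det_transpose] using
    mul_areaForm_mul_transpose Aᵀ

theorem det_colMatrix_areaForm_mulVec (X Y : Plane) :
    (colMatrix 1 X (areaForm ℝ *ᵥ Y)).det = -(X ⬝ᵥ Y) := by
  simp only [colMatrix, areaForm, Matrix.det_fin_two, Matrix.mulVec, dotProduct,
    Fin.sum_univ_two, Matrix.of_apply, Matrix.cons_val]
  ring

theorem mul_colMatrix (A : Mat2) (ε : ℝ) (X Y : Plane) :
    A * colMatrix ε X Y = colMatrix ε (A *ᵥ X) (A *ᵥ Y) := by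
  ext i j
  fin_cases i <;> fin_cases j <;>
    simp only [colMatrix, Matrix.mul_apply, Matrix.mulVec, dotProduct, Fin.sum_univ_two,
      Fin.zero_eta, Fin.mk_one, Matrix.of_apply, Matrix.cons_val] <;>
    ring

/-- The coordinates of a symmetric `2 × 2` matrix. -/
def symCoords (X : Matrix (Fin 2) (Fin 2) R) : Fin 3 → R := ![X 0 0, X 0 1, X 1 1]

/-- The symmetric square of `A`: the matrix of the congruence `X ↦ Aᵀ X A` on symmetric
matrices in the coordinates `symCoords`, acting on row vectors. -/
def symSquare (A : Matrix (Fin 2) (Fin 2) R) : Matrix (Fin 3) (Fin 3) R :=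
  !![A 0 0 ^ 2, A 0 0 * A 0 1, A 0 1 ^ 2;
     2 * A 0 0 * A 1 0, A 0 0 * A 1 1 + A 0 1 * A 1 0, 2 * A 0 1 * A 1 1;
     A 1 0 ^ 2, A 1 0 * A 1 1, A 1 1 ^ 2]

theorem det_symSquare (A : Matrix (Fin 2) (Fin 2) R) : (symSquare A).det = A.det ^ 3 := by
  simp only [symSquare, Matrix.det_fin_three, Matrix.det_fin_two, Matrix.of_apply,
    Matrix.cons_val]
  ring

theorem symCoords_transpose_mul_mul (A : Matrix (Fin 2) (Fin 2) R)
    {X : Matrix (Fin 2) (Fin 2) R} (hX : X.IsSymm) :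
    symCoords (Aᵀ * X * A) = symCoords X ᵥ* symSquare A := by
  have h10 : X 1 0 = X 0 1 := hX.apply 0 1
  ext k
  fin_cases k <;>
    simp only [symCoords, symSquare, Matrix.mul_apply, Matrix.transpose_apply, Matrix.vecMul,
      dotProduct, Fin.sum_univ_two, Fin.sum_univ_three, h10, Fin.zero_eta, Fin.mk_one,
      Fin.reduceFinMk, Matrix.of_apply, Matrix.cons_val] <;>
    ring

/-- The volume spanned by three symmetric `2 × 2` matrices in the coordinates `symCoords`. -/
def symDet (X Y Z : Matrix (Fin 2) (Fin 2) R) : R :=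
  (Matrix.of ![symCoords X, symCoords Y, symCoords Z]).det

theorem symDet_transpose_mul_mul (A : Matrix (Fin 2) (Fin 2) R)
    {X Y Z : Matrix (Fin 2) (Fin 2) R} (hX : X.IsSymm) (hY : Y.IsSymm) (hZ : Z.IsSymm) :
    symDet (Aᵀ * X * A) (Aᵀ * Y * A) (Aᵀ * Z * A) = A.det ^ 3 * symDet X Y Z := by
  have rows : Matrix.of ![symCoords X ᵥ* symSquare A, symCoords Y ᵥ* symSquare A,
      symCoords Z ᵥ* symSquare A] =
      Matrix.of ![symCoords X, symCoords Y, symCoords Z] * symSquare A := by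
    ext i j
    fin_cases i <;> rfl
  rw [symDet, symCoords_transpose_mul_mul A hX, symCoords_transpose_mul_mul A hY,
    symCoords_transpose_mul_mul A hZ, rows, Matrix.det_mul, det_symSquare, mul_comm, symDet]

theorem symDet_sum_smul (J : Matrix (Fin 2) (Fin 2) R) (X : Fin 2 → Matrix (Fin 2) (Fin 2) R)
    (Z : Matrix (Fin 2) (Fin 2) R) :
    symDet (∑ m, J m 0 • X m) (∑ m, J m 1 • X m) Z = J.det * symDet (X 0) (X 1) Z := by
  simp only [symDet, symCoords, Matrix.det_fin_three, Matrix.det_fin_two, Matrix.of_apply,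
    Matrix.cons_val, Fin.sum_univ_two, Matrix.add_apply, Matrix.smul_apply, smul_eq_mul]
  ring

theorem symDet_smul (c : R) (X Y Z : Matrix (Fin 2) (Fin 2) R) :
    symDet X Y (c • Z) = c * symDet X Y Z := by
  simp only [symDet, symCoords, Matrix.det_fin_three, Matrix.of_apply, Matrix.cons_val,
    Matrix.smul_apply, smul_eq_mul]
  ring

theorem sign_eq_div_abs (x : ℝ) : Real.sign x = x / |x| := by
  rcases lt_trichotomy x 0 with hx | rfl | hx
  · rw [Real.sign_of_neg hx, abs_of_neg hx, div_neg, div_self hx.ne]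
  · simp
  · rw [Real.sign_of_pos hx, abs_of_pos hx, div_self hx.ne']

theorem sign_mul_self_eq_one {x : ℝ} (hx : x ≠ 0) : Real.sign x * Real.sign x = 1 := by
  rcases Real.sign_apply_eq_of_ne_zero x hx with h | h <;> rw [h] <;> norm_num

end MatrixAlgebra

/-! ### Smoothness of the invariants -/

section Smoothness

variable {𝕜 E : Type*} [NontriviallyNormedField 𝕜] [NormedAddCommGroup E] [NormedSpace 𝕜 E]
  {r : ℕ∞ω} {s : Set E} {n : Type*} [Fintype n] [DecidableEq n]

theorem contDiffOn_det {A : E → Matrix n n 𝕜} (hA : ∀ i j, ContDiffOn 𝕜 r (fun x => A x i j) s) :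
    ContDiffOn 𝕜 r (fun x => (A x).det) s := by
  simp only [Matrix.det_apply, Units.smul_def, zsmul_eq_mul]
  exact ContDiffOn.sum fun σ _ => contDiffOn_const.mul (contDiffOn_prod fun i _ => hA (σ i) i)

theorem contDiffOn_inv_apply {A : E → Matrix n n 𝕜}
    (hA : ∀ i j, ContDiffOn 𝕜 r (fun x => A x i j) s) (hdet : ∀ x ∈ s, (A x).det ≠ 0) (i j : n) :
    ContDiffOn 𝕜 r (fun x => (A x)⁻¹ i j) s := by
  have adjugate : ContDiffOn 𝕜 r (fun x => (A x).adjugate i j) s := by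
    simp only [Matrix.adjugate_apply]
    refine contDiffOn_det fun k l => ?_
    simp only [Matrix.updateRow_apply]
    split_ifs
    exacts [contDiffOn_const, hA k l]
  simp only [Matrix.inv_def, Matrix.smul_apply, smul_eq_mul, Ring.inverse_eq_inv]
  exact ((contDiffOn_det hA).inv hdet).mul adjugate

theorem contDiffOn_sqrt_abs {E : Type*} [NormedAddCommGroup E] [NormedSpace ℝ E] {r : ℕ∞}
    {s : Set E} {F : E → ℝ} (hF : ContDiffOn ℝ r F s) (hne : ∀ x ∈ s, F x ≠ 0) :
    ContDiffOn ℝ r (fun x => √|F x|) s :=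
  fun x hx => ((contDiffAt_abs (hne x hx)).comp_contDiffWithinAt x (hF x hx)).sqrt
    (abs_ne_zero.2 (hne x hx))

end Smoothness

namespace AdaptedMetric

variable (g : AdaptedMetric) {t : Plane}

theorem fUp_eq (t : Plane) : g.fUp t = (g.f t * (g.h t)⁻¹)ᵀ := by
  ext k j
  simp only [fUp, Matrix.of_apply, Matrix.transpose_apply, Matrix.mul_apply]

theorem orbit_eq (t : Plane) : g.orbit t = g.b t - g.f t * (g.h t)⁻¹ * (g.f t)ᵀ := by
  ext i j
  simp only [orbit, Matrix.of_apply, Matrix.sub_apply, Matrix.mul_apply, Finset.sum_mul,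
    Matrix.transpose_apply]
  rw [Finset.sum_comm]
  simp only [mul_right_comm]

theorem detH_ne_zero (ht : t ∈ g.U) : g.detH t ≠ 0 := g.leaves_nonnull t ht

theorem det_orbit_ne_zero (ht : t ∈ g.U) : (g.orbit t).det ≠ 0 := by
  have : Invertible (g.h t) :=
    Matrix.invertibleOfIsUnitDet _ (g.leaves_nonnull t ht).isUnit
  have schur := g.nondegenerate t ht
  rw [Matrix.det_fromBlocks₂₂, Matrix.invOf_eq_nonsing_inv, ← orbit_eq] at schur
  exact right_ne_zero_of_mul schur

theorem sqrt_detH_ne_zero (ht : t ∈ g.U) : √|g.detH t| ≠ 0 :=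
  (Real.sqrt_pos.2 (abs_pos.2 (g.detH_ne_zero ht))).ne'

theorem sqrtOrbit_ne_zero (ht : t ∈ g.U) : g.sqrtOrbit t ≠ 0 :=
  (Real.sqrt_pos.2 (abs_pos.2 (g.det_orbit_ne_zero ht))).ne'

theorem smooth_detH : ContDiffOn ℝ ∞ g.detH g.U := contDiffOn_det g.smooth_h

theorem smooth_fUp (k j : Fin 2) : ContDiffOn ℝ ∞ (fun t => g.fUp t k j) g.U :=
  ContDiffOn.sum (s := Finset.univ) fun s _ =>
    (g.smooth_f j s).mul (contDiffOn_inv_apply g.smooth_h g.leaves_nonnull s k)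

theorem smooth_orbit (i j : Fin 2) : ContDiffOn ℝ ∞ (fun t => g.orbit t i j) g.U :=
  (g.smooth_b i j).sub <| ContDiffOn.sum fun k _ => ContDiffOn.sum fun l _ =>
    ((g.smooth_f i k).mul (g.smooth_f j l)).mul
      (contDiffOn_inv_apply g.smooth_h g.leaves_nonnull k l)

theorem smooth_sqrtOrbit : ContDiffOn ℝ ∞ g.sqrtOrbit g.U :=
  contDiffOn_sqrt_abs (contDiffOn_det g.smooth_orbit) fun _ ht => g.det_orbit_ne_zero ht

theorem smooth_dh (k l i : Fin 2) : ContDiffOn ℝ ∞ (g.dh k l i) g.U :=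
  contDiffOn_pd g.isOpen_U (g.smooth_h k l) i

theorem smooth_rho (i j : Fin 2) : ContDiffOn ℝ ∞ (fun t => g.rho t i j) g.U := by
  have smooth_sigma (i : Fin 2) : ContDiffOn ℝ ∞ (fun t => g.sigma t i) g.U :=
    (contDiffOn_pd g.isOpen_U g.smooth_detH i).div g.smooth_detH fun _ ht => g.detH_ne_zero ht
  exact (smooth_sigma i).mul (smooth_sigma j)

theorem smooth_chi (i j : Fin 2) : ContDiffOn ℝ ∞ (fun t => g.chi t i j) g.U :=
  have d := g.smooth_dh
  (contDiffOn_const.div (contDiffOn_const.mul g.smooth_detH)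
    fun _ ht => mul_ne_zero two_ne_zero (g.detH_ne_zero ht)).mul
    ((((d _ _ _).mul (d _ _ _)).sub ((d _ _ _).mul (d _ _ _))).add
      (((d _ _ _).mul (d _ _ _)).sub ((d _ _ _).mul (d _ _ _))))

theorem smooth_gamma (i j : Fin 2) : ContDiffOn ℝ ∞ (fun t => g.gamma t i j) g.U :=
  (g.smooth_chi i j).sub (contDiffOn_const.mul (g.smooth_rho i j))

theorem smooth_traceInv {μ : Plane → Mat2} (hμ : ∀ i j, ContDiffOn ℝ ∞ (fun t => μ t i j) g.U) :
    ContDiffOn ℝ ∞ (g.traceInv μ) g.U :=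
  ContDiffOn.sum fun i _ => ContDiffOn.sum fun j _ =>
    (hμ i j).mul (contDiffOn_inv_apply g.smooth_orbit (fun _ ht => g.det_orbit_ne_zero ht) i j)

theorem smooth_detInv {μ : Plane → Mat2} (hμ : ∀ i j, ContDiffOn ℝ ∞ (fun t => μ t i j) g.U) :
    ContDiffOn ℝ ∞ (g.detInv μ) g.U :=
  (contDiffOn_det hμ).div (contDiffOn_det g.smooth_orbit) fun _ ht => g.det_orbit_ne_zero ht

theorem smooth_curv (k : Fin 2) : ContDiffOn ℝ ∞ (fun t => g.curv t k) g.U :=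
  ((contDiffOn_pd g.isOpen_U (g.smooth_fUp k 0) 1).sub
    (contDiffOn_pd g.isOpen_U (g.smooth_fUp k 1) 0)).div g.smooth_sqrtOrbit
    fun _ ht => g.sqrtOrbit_ne_zero ht

theorem smooth_ellC : ContDiffOn ℝ ∞ g.ellC g.U :=
  ContDiffOn.sum fun k _ => ContDiffOn.sum fun l _ =>
    ((g.smooth_h k l).mul (g.smooth_curv k)).mul (g.smooth_curv l)

theorem smooth_thetaI : ContDiffOn ℝ ∞ g.thetaI g.U := by
  have smooth_prefactor : ContDiffOn ℝ ∞ (fun t => 1 / (√|g.detH t| * g.sqrtOrbit t)) g.U :=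
    contDiffOn_const.div
      ((contDiffOn_sqrt_abs g.smooth_detH fun _ ht => g.detH_ne_zero ht).mul g.smooth_sqrtOrbit)
      fun t ht => mul_ne_zero (g.sqrt_detH_ne_zero ht) (g.sqrtOrbit_ne_zero ht)
  have c := g.smooth_curv
  refine smooth_prefactor.mul (contDiffOn_det fun i j => ?_)
  fin_cases i <;> fin_cases j
  exacts [g.smooth_dh 0 0 0, g.smooth_dh 0 1 0, g.smooth_dh 1 1 0, g.smooth_dh 0 0 1,
    g.smooth_dh 0 1 1, g.smooth_dh 1 1 1, (c 1).pow 2, ((c 0).mul (c 1)).neg, (c 0).pow 2]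

theorem smooth_inv (a : Fin 6) : ContDiffOn ℝ ∞ (g.inv a) g.U := by
  fin_cases a
  exacts [g.smooth_traceInv g.smooth_rho, g.smooth_traceInv g.smooth_chi,
    g.smooth_detInv g.smooth_chi, g.smooth_detInv g.smooth_gamma, g.smooth_ellC,
    g.smooth_thetaI.pow 2]

theorem contDiffAt_inv_pair (a b : Fin 6) {t : Plane} (ht : t ∈ g.U) :
    ContDiffAt ℝ ∞ (fun s => ![g.inv a s, g.inv b s]) t := by
  have hinv (c : Fin 6) : ContDiffAt ℝ ∞ (g.inv c) t :=
    (g.smooth_inv c).contDiffAt (g.isOpen_U.mem_nhds ht)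
  exact contDiffAt_pi.2 (Fin.forall_fin_two.2 ⟨hinv a, hinv b⟩)

end AdaptedMetric

/-! ### Matrix formulas for the invariants -/

namespace AdaptedMetric

variable (g : AdaptedMetric) {t : Plane}

theorem h_mul_fUp (ht : t ∈ g.U) : g.h t * g.fUp t = (g.f t)ᵀ := by
  rw [fUp_eq, Matrix.transpose_mul, Matrix.transpose_nonsing_inv, g.symm_h t ht,
    Matrix.mul_nonsing_inv_cancel_left _ _ (g.detH_ne_zero ht).isUnit]

theorem orbit_eq_sub_fUp (ht : t ∈ g.U) :
    g.orbit t = g.b t - (g.fUp t)ᵀ * g.h t * g.fUp t := by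
  rw [orbit_eq, Matrix.mul_assoc _ (g.h t), g.h_mul_fUp ht, fUp_eq, Matrix.transpose_transpose]

/-- The matrix `∂h/∂tⁱ`. -/
def dhMatrix (i : Fin 2) (t : Plane) : Mat2 := Matrix.of fun k l => g.dh k l i t

theorem dhMatrix_isSymm (ht : t ∈ g.U) (i : Fin 2) : (g.dhMatrix i t).IsSymm := by
  ext k l
  refine pd_congr ?_ i
  filter_upwards [g.isOpen_U.mem_nhds ht] with s hs using (g.symm_h s hs).apply k l

theorem chi_apply_eq_trace (t : Plane) (i j : Fin 2) :
    g.chi t i j = 1 / (2 * g.detH t) * (g.dhMatrix i t * (g.dhMatrix j t).adjugate).trace := by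
  simp only [chi, dhMatrix, Matrix.adjugate_fin_two, Matrix.trace_fin_two, Matrix.mul_apply,
    Fin.sum_univ_two, Matrix.of_apply, Matrix.cons_val]
  ring

theorem traceInv_eq_trace (μ : Plane → Mat2) (t : Plane) :
    g.traceInv μ t = ((μ t)ᵀ * (g.orbit t)⁻¹).trace := by
  simp only [traceInv, Matrix.trace, Matrix.diag_apply, Matrix.mul_apply, Matrix.transpose_apply]
  exact Finset.sum_comm

theorem Crho_eq_dotProduct (t : Plane) :
    g.Crho t = g.sigma t ⬝ᵥ ((g.orbit t)⁻¹ *ᵥ g.sigma t) := by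
  simp only [Crho, traceInv, rho, Matrix.of_apply, dotProduct, Matrix.mulVec, Finset.mul_sum]
  exact Finset.sum_congr rfl fun i _ => Finset.sum_congr rfl fun j _ => by ring

theorem ellC_eq_dotProduct (t : Plane) : g.ellC t = g.curv t ⬝ᵥ (g.h t *ᵥ g.curv t) := by
  simp only [ellC, dotProduct, Matrix.mulVec, Finset.mul_sum]
  exact Finset.sum_congr rfl fun i _ => Finset.sum_congr rfl fun j _ => by ring

theorem mean_eq_mulVec (t : Plane) :
    g.mean t = (-(1 / 2) : ℝ) • ((g.orbit t)⁻¹ *ᵥ g.sigma t) := rfl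

theorem meanPerp_eq_areaForm (t : Plane) :
    g.meanPerp t = (-(1 / 2) / g.sqrtOrbit t) • (areaForm ℝ *ᵥ g.sigma t) := by
  ext i
  fin_cases i <;>
    simp only [meanPerp, sigma, areaForm, Matrix.mulVec, dotProduct, Fin.sum_univ_two,
      Pi.smul_apply, smul_eq_mul, div_eq_mul_inv, mul_inv,
      Fin.zero_eta, Fin.mk_one, Matrix.of_apply, Matrix.cons_val] <;>
    ring

theorem curvPerp_eq_areaForm (ht : t ∈ g.U) :
    g.curvPerp t = (√|g.detH t|)⁻¹ • (areaForm ℝ *ᵥ (g.h t *ᵥ g.curv t)) := by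
  have h10 : g.h t 1 0 = g.h t 0 1 := (g.symm_h t ht).apply 0 1
  ext k
  fin_cases k <;>
    simp only [curvPerp, areaForm, Matrix.mulVec, dotProduct, Fin.sum_univ_two, h10,
      Pi.smul_apply, smul_eq_mul, div_eq_mul_inv,
      Fin.zero_eta, Fin.mk_one, Matrix.of_apply, Matrix.cons_val] <;>
    ring

theorem thetaI_eq_symDet (t : Plane) :
    g.thetaI t = 1 / (√|g.detH t| * g.sqrtOrbit t) *
      symDet (g.dhMatrix 0 t) (g.dhMatrix 1 t)
        (Matrix.vecMulVec (areaForm ℝ *ᵥ g.curv t) (areaForm ℝ *ᵥ g.curv t)) := by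
  rw [thetaI, symDet]
  congr 2
  ext i j
  fin_cases i <;> fin_cases j <;>
    simp only [symCoords, dhMatrix, areaForm, Matrix.vecMulVec_apply, Matrix.mulVec, dotProduct,
      Fin.sum_univ_two, Fin.reduceFinMk,
      Fin.zero_eta, Fin.mk_one, Matrix.of_apply, Matrix.cons_val] <;>
    ring

theorem isUnit_det_curvFrame (ht : t ∈ g.U) (hC : g.ellC t ≠ 0) :
    IsUnit (colMatrix 1 (g.curv t) (g.curvPerp t)).det := by
  rw [curvPerp_eq_areaForm g ht, ← Matrix.mulVec_smul, det_colMatrix_areaForm_mulVec,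
    dotProduct_smul, ← ellC_eq_dotProduct, isUnit_iff_ne_zero]
  exact neg_ne_zero.2 (smul_ne_zero (inv_ne_zero (g.sqrt_detH_ne_zero ht)) hC)

theorem isUnit_det_meanFrame (ht : t ∈ g.U) (hC : g.Crho t ≠ 0) :
    IsUnit (colMatrix 1 (g.mean t) (g.meanPerp t)).det := by
  rw [meanPerp_eq_areaForm, mean_eq_mulVec, ← Matrix.mulVec_smul (areaForm ℝ),
    det_colMatrix_areaForm_mulVec, dotProduct_smul, smul_dotProduct, dotProduct_comm,
    ← Crho_eq_dotProduct, isUnit_iff_ne_zero]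
  exact neg_ne_zero.2 (smul_ne_zero (div_ne_zero (by norm_num) (g.sqrtOrbit_ne_zero ht))
    (smul_ne_zero (by norm_num) hC))

end AdaptedMetric

/-! ### Transformation of tensors and frames -/

namespace AdaptedTransformation

variable {g g' : AdaptedMetric} (P : AdaptedTransformation g g') {t : Plane}

theorem isUnit_det_α : IsUnit P.α.val.det :=
  (Matrix.isUnit_iff_isUnit_det _).1 P.α.isUnit

theorem contDiffAt_φ (ht : t ∈ P.V) : ContDiffAt ℝ ∞ P.φ t :=
  P.smooth_φ.contDiffAt (P.isOpen_V.mem_nhds ht)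

theorem contDiffAt_ψ (ht : t ∈ P.V) : ContDiffAt ℝ ∞ P.ψ t :=
  P.smooth_ψ.contDiffAt (P.isOpen_V.mem_nhds ht)

theorem ε₁_mul_self (ht : t ∈ P.V) : P.ε₁ t * P.ε₁ t = 1 :=
  sign_mul_self_eq_one (P.jacobian_ne t ht)

theorem ε₁_mul_abs_det (ht : t ∈ P.V) : P.ε₁ t * |(jac P.φ t).det| = (jac P.φ t).det := by
  rw [ε₁, sign_eq_div_abs, div_mul_cancel₀ _ (abs_ne_zero.2 (P.jacobian_ne t ht))]

theorem ε₂_mul_abs_det : P.ε₂ * |P.α.val.det| = P.α.val.det := by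
  rw [ε₂, sign_eq_div_abs, div_mul_cancel₀ _ (abs_ne_zero.2 P.isUnit_det_α.ne_zero)]

namespace CondV

variable {P} (hP : P.CondV) (ht : t ∈ P.V)

include hP ht

theorem h_eq : g.h t = P.α.valᵀ * g'.h (P.φ t) * P.α.val := by
  ext k l
  rw [(hP t ht).2.2 k l]
  simp only [Matrix.mul_apply, Matrix.transpose_apply, Fin.sum_univ_two]
  ring

theorem f_eq :
    g.f t = ((jac P.φ t)ᵀ * g'.f (P.φ t) + (jac P.ψ t)ᵀ * g'.h (P.φ t)) * P.α.val := by
  have h10 : g'.h (P.φ t) 1 0 = g'.h (P.φ t) 0 1 := (g'.symm_h _ (P.mapsTo ht)).apply 0 1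
  ext i k
  rw [(hP t ht).2.1 i k]
  simp only [Matrix.mul_apply, Matrix.add_apply, Matrix.transpose_apply, Fin.sum_univ_two, h10]
  ring

theorem b_eq :
    g.b t = (jac P.φ t)ᵀ * g'.b (P.φ t) * jac P.φ t + (jac P.φ t)ᵀ * g'.f (P.φ t) * jac P.ψ t
      + (jac P.ψ t)ᵀ * (g'.f (P.φ t))ᵀ * jac P.φ t
      + (jac P.ψ t)ᵀ * g'.h (P.φ t) * jac P.ψ t := by
  ext i j
  rw [(hP t ht).1 i j]
  simp only [Matrix.mul_apply, Matrix.add_apply, Matrix.transpose_apply, Fin.sum_univ_two]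
  ring

theorem α_mul_fUp_eq : P.α.val * g.fUp t = g'.fUp (P.φ t) * jac P.φ t + jac P.ψ t := by
  have hα : IsUnit P.α.valᵀ.det := by rw [Matrix.det_transpose]; exact P.isUnit_det_α
  have hh' : IsUnit (g'.h (P.φ t)).det := (g'.detH_ne_zero (P.mapsTo ht)).isUnit
  have hαh' : IsUnit (P.α.valᵀ * g'.h (P.φ t)) := by
    rw [Matrix.isUnit_iff_isUnit_det, Matrix.det_mul]
    exact hα.mul hh'
  apply hαh'.mul_left_cancel
  calc P.α.valᵀ * g'.h (P.φ t) * (P.α.val * g.fUp t)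
      = (g.f t)ᵀ := by
        rw [← Matrix.mul_assoc, ← hP.h_eq ht, g.h_mul_fUp (P.V_subset ht)]
    _ = P.α.valᵀ * ((g'.f (P.φ t))ᵀ * jac P.φ t + g'.h (P.φ t) * jac P.ψ t) := by
        simp only [hP.f_eq ht, Matrix.transpose_mul, Matrix.transpose_add,
          Matrix.transpose_transpose, (g'.symm_h _ (P.mapsTo ht)).eq]
    _ = P.α.valᵀ * g'.h (P.φ t) * (g'.fUp (P.φ t) * jac P.φ t + jac P.ψ t) := by
        rw [← g'.h_mul_fUp (P.mapsTo ht), Matrix.mul_assoc, Matrix.mul_assoc, ← Matrix.mul_add]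

theorem orbit_eq : g.orbit t = (jac P.φ t)ᵀ * g'.orbit (P.φ t) * jac P.φ t := by
  have vertical_part : (g.fUp t)ᵀ * g.h t * g.fUp t =
      (g'.fUp (P.φ t) * jac P.φ t + jac P.ψ t)ᵀ * g'.h (P.φ t) *
        (g'.fUp (P.φ t) * jac P.φ t + jac P.ψ t) := by
    rw [← hP.α_mul_fUp_eq ht, hP.h_eq ht, Matrix.transpose_mul]
    simp only [Matrix.mul_assoc]
  have hf' : (g'.f (P.φ t))ᵀ = g'.h (P.φ t) * g'.fUp (P.φ t) :=
    (g'.h_mul_fUp (P.mapsTo ht)).symm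
  have hf : g'.f (P.φ t) = (g'.fUp (P.φ t))ᵀ * g'.h (P.φ t) := by
    rw [← Matrix.transpose_transpose (g'.f (P.φ t)), hf', Matrix.transpose_mul,
      (g'.symm_h _ (P.mapsTo ht)).eq]
  rw [g.orbit_eq_sub_fUp (P.V_subset ht), g'.orbit_eq_sub_fUp (P.mapsTo ht), vertical_part,
    hP.b_eq ht, hf', hf]
  simp only [Matrix.transpose_add, Matrix.transpose_mul, Matrix.add_mul, Matrix.mul_add,
    Matrix.sub_mul, Matrix.mul_sub, Matrix.mul_assoc]
  abel

theorem detH_eq : g.detH t = P.α.val.det ^ 2 * g'.detH (P.φ t) := by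
  rw [AdaptedMetric.detH, hP.h_eq ht, det_transpose_mul_mul, AdaptedMetric.detH]

theorem sqrt_detH_eq : √|g.detH t| = |P.α.val.det| * √|g'.detH (P.φ t)| := by
  rw [hP.detH_eq ht, abs_mul, abs_sq, Real.sqrt_mul (sq_nonneg _), Real.sqrt_sq_eq_abs]

theorem sqrtOrbit_eq : g.sqrtOrbit t = |(jac P.φ t).det| * g'.sqrtOrbit (P.φ t) := by
  rw [AdaptedMetric.sqrtOrbit, hP.orbit_eq ht, det_transpose_mul_mul, abs_mul, abs_sq,
    Real.sqrt_mul (sq_nonneg _), Real.sqrt_sq_eq_abs, AdaptedMetric.sqrtOrbit]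

theorem dhMatrix_eq (i : Fin 2) :
    g.dhMatrix i t =
      ∑ m, jac P.φ t m i • (P.α.valᵀ * g'.dhMatrix m (P.φ t) * P.α.val) := by
  have hφ := (P.contDiffAt_φ ht).differentiableAt (by simp)
  have hh' (r s : Fin 2) : DifferentiableAt ℝ (fun x => g'.h x r s) (P.φ t) :=
    ((g'.smooth_h r s).contDiffAt (g'.isOpen_U.mem_nhds (P.mapsTo ht))).differentiableAt (by simp)
  have hh'φ (r s : Fin 2) : DifferentiableAt ℝ (fun x => g'.h (P.φ x) r s) t :=
    (hh' r s).comp t hφ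
  ext k l
  have h_near : (fun x => g.h x k l) =ᶠ[𝓝 t]
      fun x => ∑ r, P.α.val r k * ∑ s, P.α.val s l * g'.h (P.φ x) r s := by
    filter_upwards [P.isOpen_V.mem_nhds ht] with x hx
    rw [(hP x hx).2.2 k l]
    simp only [Finset.mul_sum]
    exact Finset.sum_congr rfl fun r _ => Finset.sum_congr rfl fun s _ => by ring
  have dh_eq : g.dh k l i t = ∑ r, P.α.val r k * ∑ s, P.α.val s l *
      ∑ m, g'.dh r s m (P.φ t) * jac P.φ t m i := by
    rw [AdaptedMetric.dh, pd_congr h_near, pd_sum_const_mul fun r _ =>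
      DifferentiableAt.fun_sum fun s _ => (hh'φ r s).const_mul _]
    simp only [pd_sum_const_mul fun s _ => hh'φ _ s, pd_comp (hh' _ _) hφ, AdaptedMetric.dh]
  rw [AdaptedMetric.dhMatrix, Matrix.of_apply, dh_eq]
  simp only [AdaptedMetric.dhMatrix, Matrix.mul_apply, Matrix.sum_apply, Matrix.smul_apply,
    Matrix.transpose_apply, Matrix.of_apply, Fin.sum_univ_two, smul_eq_mul]
  ring

theorem sigma_eq : g.sigma t = g'.sigma (P.φ t) ᵥ* jac P.φ t := by
  have hφ := (P.contDiffAt_φ ht).differentiableAt (by simp)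
  have hdetH' : DifferentiableAt ℝ g'.detH (P.φ t) :=
    (g'.smooth_detH.contDiffAt (g'.isOpen_U.mem_nhds (P.mapsTo ht))).differentiableAt (by simp)
  have detH_near : g.detH =ᶠ[𝓝 t] fun x => P.α.val.det ^ 2 * g'.detH (P.φ x) := by
    filter_upwards [P.isOpen_V.mem_nhds ht] with x hx using hP.detH_eq hx
  have hdetH'φ : DifferentiableAt ℝ (fun x => g'.detH (P.φ x)) t := hdetH'.comp t hφ
  ext i
  rw [AdaptedMetric.sigma, pd_congr detH_near, pd_const_mul hdetH'φ,
    pd_comp hdetH' hφ, hP.detH_eq ht,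
    mul_div_mul_left _ _ (pow_ne_zero 2 P.isUnit_det_α.ne_zero), Finset.sum_div]
  exact Finset.sum_congr rfl fun m _ => mul_div_right_comm _ _ _

theorem rho_eq : g.rho t = (jac P.φ t)ᵀ * g'.rho (P.φ t) * jac P.φ t := by
  ext i j
  simp only [AdaptedMetric.rho, hP.sigma_eq ht, Matrix.vecMul, dotProduct, Matrix.of_apply,
    Matrix.mul_apply, Matrix.transpose_apply, Fin.sum_univ_two]
  ring

theorem chi_eq : g.chi t = (jac P.φ t)ᵀ * g'.chi (P.φ t) * jac P.φ t := by
  have hα := P.isUnit_det_α.ne_zero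
  have hdetH' := g'.detH_ne_zero (P.mapsTo ht)
  ext i j
  rw [AdaptedMetric.chi_apply_eq_trace, hP.dhMatrix_eq ht, hP.dhMatrix_eq ht,
    adjugate_sum_smul_fin_two]
  simp only [Finset.sum_mul, Finset.mul_sum, Matrix.smul_mul, Matrix.mul_smul, Matrix.trace_sum,
    Matrix.trace_smul, trace_mul_adjugate_transpose_mul_mul, hP.detH_eq ht, Matrix.mul_apply,
    Matrix.transpose_apply, AdaptedMetric.chi_apply_eq_trace, smul_eq_mul]
  refine Finset.sum_congr rfl fun m _ => Finset.sum_congr rfl fun l _ => ?_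
  field_simp

theorem gamma_eq : g.gamma t = (jac P.φ t)ᵀ * g'.gamma (P.φ t) * jac P.φ t := by
  simp only [AdaptedMetric.gamma, hP.chi_eq ht, hP.rho_eq ht, Matrix.mul_sub, Matrix.sub_mul,
    Matrix.mul_smul, Matrix.smul_mul]

theorem traceInv_eq {μ μ' : Plane → Mat2}
    (hμ : μ t = (jac P.φ t)ᵀ * μ' (P.φ t) * jac P.φ t) :
    g.traceInv μ t = g'.traceInv μ' (P.φ t) := by
  have hJ : IsUnit (jac P.φ t).det := (P.jacobian_ne t ht).isUnit
  rw [AdaptedMetric.traceInv_eq_trace, AdaptedMetric.traceInv_eq_trace, hμ, hP.orbit_eq ht,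
    ← mul_inv_transpose_mul_mul_mul_transpose hJ (g'.orbit (P.φ t)), Matrix.transpose_mul,
    Matrix.transpose_mul, Matrix.transpose_transpose, Matrix.mul_assoc, Matrix.trace_mul_comm]
  simp only [Matrix.mul_assoc]

theorem detInv_eq {μ μ' : Plane → Mat2}
    (hμ : μ t = (jac P.φ t)ᵀ * μ' (P.φ t) * jac P.φ t) :
    g.detInv μ t = g'.detInv μ' (P.φ t) := by
  rw [AdaptedMetric.detInv, hμ, hP.orbit_eq ht, det_transpose_mul_mul, det_transpose_mul_mul,
    mul_div_mul_left _ _ (pow_ne_zero 2 (P.jacobian_ne t ht)), AdaptedMetric.detInv]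

theorem jac_mulVec_mean_eq : jac P.φ t *ᵥ g.mean t = g'.mean (P.φ t) := by
  have hJ : IsUnit (jac P.φ t).det := (P.jacobian_ne t ht).isUnit
  rw [AdaptedMetric.mean_eq_mulVec, AdaptedMetric.mean_eq_mulVec, hP.sigma_eq ht,
    hP.orbit_eq ht, Matrix.mulVec_smul, ← Matrix.mulVec_transpose, Matrix.mulVec_mulVec,
    Matrix.mulVec_mulVec, mul_inv_transpose_mul_mul_mul_transpose hJ]

theorem jac_mulVec_meanPerp_eq :
    jac P.φ t *ᵥ g.meanPerp t = P.ε₁ t • g'.meanPerp (P.φ t) := by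
  have habs : |(jac P.φ t).det| ≠ 0 := abs_ne_zero.2 (P.jacobian_ne t ht)
  rw [AdaptedMetric.meanPerp_eq_areaForm, AdaptedMetric.meanPerp_eq_areaForm, hP.sigma_eq ht,
    hP.sqrtOrbit_eq ht, Matrix.mulVec_smul, ← Matrix.mulVec_transpose, Matrix.mulVec_mulVec,
    Matrix.mulVec_mulVec, mul_areaForm_mul_transpose, Matrix.smul_mulVec,
    smul_smul, smul_smul]
  congr 1
  field_simp
  rw [mul_comm _ (P.ε₁ t), P.ε₁_mul_abs_det ht]

theorem curl_fUp_eq : (P.α.val *ᵥ fun k => curl (fun s => g.fUp s k) t) =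
    (jac P.φ t).det • fun k => curl (fun s => g'.fUp s k) (P.φ t) := by
  ext k
  have fUp_near : (fun s => P.α.val k ᵥ* g.fUp s) =ᶠ[𝓝 t]
      fun s => g'.fUp (P.φ s) k ᵥ* jac P.φ s + jac P.ψ s k := by
    filter_upwards [P.isOpen_V.mem_nhds ht] with s hs using congrFun (hP.α_mul_fUp_eq hs) k
  have hfUp (k j : Fin 2) : DifferentiableAt ℝ (fun s => g.fUp s k j) t :=
    ((g.smooth_fUp k j).contDiffAt (g.isOpen_U.mem_nhds (P.V_subset ht))).differentiableAt
      (by simp)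
  have hfUp' : DifferentiableAt ℝ (fun s => g'.fUp s k) (P.φ t) :=
    differentiableAt_pi.2 fun j => ((g'.smooth_fUp k j).contDiffAt
      (g'.isOpen_U.mem_nhds (P.mapsTo ht))).differentiableAt (by simp)
  have hφ : ContDiffAt ℝ 2 P.φ t := (P.contDiffAt_φ ht).of_le (by norm_cast)
  have hψ : ContDiffAt ℝ 2 (fun s => P.ψ s k) t :=
    contDiffAt_pi.1 ((P.contDiffAt_ψ ht).of_le (by norm_cast)) k
  calc (P.α.val *ᵥ fun k => curl (fun s => g.fUp s k) t) k
      = curl (fun s => P.α.val k ᵥ* g.fUp s) t := (curl_vecMul hfUp _).symm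
    _ = curl (fun s => g'.fUp (P.φ s) k ᵥ* jac P.φ s) t + curl (fun s => jac P.ψ s k) t := by
        rw [curl_congr fUp_near, curl_add]
        · exact differentiableAt_pullback hfUp' hφ
        · exact differentiableAt_pi.2 (differentiableAt_pd hψ)
    _ = (jac P.φ t).det * curl (fun s => g'.fUp s k) (P.φ t) := by
        rw [curl_pullback hfUp' hφ, show curl (fun s => jac P.ψ s k) t = 0 from
          curl_gradient hψ, add_zero]

end CondV
end AdaptedTransformation

theorem smul_colMatrix (c ε : ℝ) (X Y : Plane) :
    c • colMatrix ε X Y = colMatrix ε (c • X) (c • Y) := by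
  ext i j
  fin_cases i <;> fin_cases j <;> simp [colMatrix, mul_left_comm]

theorem colMatrix_smul_right (ε c : ℝ) (X Y : Plane) :
    colMatrix ε X (c • Y) = colMatrix (ε * c) X Y := by
  ext i j
  fin_cases i <;> fin_cases j <;> simp [colMatrix, mul_assoc]

namespace AdaptedTransformation

variable {g g' : AdaptedMetric} {P : AdaptedTransformation g g'} {t : Plane}

namespace CondV

variable (hP : P.CondV)

include hP

section Pointwise

variable (ht : t ∈ P.V)

include ht

theorem α_mulVec_curv_eq : P.α.val *ᵥ g.curv t = P.ε₁ t • g'.curv (P.φ t) := by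
  have hJ : |(jac P.φ t).det| ≠ 0 := abs_ne_zero.2 (P.jacobian_ne t ht)
  have curv_eq (m : AdaptedMetric) (s : Plane) :
      m.curv s = (m.sqrtOrbit s)⁻¹ • fun k => curl (fun x => m.fUp x k) s :=
    funext fun k => div_eq_inv_mul _ _
  rw [curv_eq, curv_eq, Matrix.mulVec_smul, hP.curl_fUp_eq ht, hP.sqrtOrbit_eq ht, smul_smul,
    smul_smul]
  congr 1
  field_simp
  rw [mul_comm _ (P.ε₁ t), P.ε₁_mul_abs_det ht]

theorem α_mulVec_curvPerp_eq :
    P.α.val *ᵥ g.curvPerp t = (P.ε₁ t * P.ε₂) • g'.curvPerp (P.φ t) := by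
  have hα : |P.α.val.det| ≠ 0 := abs_ne_zero.2 P.isUnit_det_α.ne_zero
  calc P.α.val *ᵥ g.curvPerp t
      = (√|g.detH t|)⁻¹ • ((P.α.val * areaForm ℝ * P.α.valᵀ) *ᵥ
          (g'.h (P.φ t) *ᵥ (P.α.val *ᵥ g.curv t))) := by
        rw [g.curvPerp_eq_areaForm (P.V_subset ht), Matrix.mulVec_smul, hP.h_eq ht]
        simp only [Matrix.mulVec_mulVec, Matrix.mul_assoc]
    _ = ((√|g.detH t|)⁻¹ * P.ε₁ t * P.α.val.det) •
          (areaForm ℝ *ᵥ (g'.h (P.φ t) *ᵥ g'.curv (P.φ t))) := by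
        rw [mul_areaForm_mul_transpose, hP.α_mulVec_curv_eq ht]
        simp only [Matrix.mulVec_smul, Matrix.smul_mulVec, smul_smul, mul_assoc]
    _ = (P.ε₁ t * P.ε₂) • g'.curvPerp (P.φ t) := by
        rw [g'.curvPerp_eq_areaForm (P.mapsTo ht), smul_smul, hP.sqrt_detH_eq ht]
        congr 1
        field_simp
        rw [mul_right_comm, mul_comm _ P.ε₂, P.ε₂_mul_abs_det, mul_comm]

theorem ellC_eq : g.ellC t = g'.ellC (P.φ t) := by
  rw [g.ellC_eq_dotProduct, g'.ellC_eq_dotProduct, hP.h_eq ht, Matrix.mul_assoc,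
    ← Matrix.mulVec_mulVec, ← Matrix.mulVec_mulVec, Matrix.dotProduct_mulVec,
    Matrix.vecMul_transpose, hP.α_mulVec_curv_eq ht, Matrix.mulVec_smul, smul_dotProduct,
    dotProduct_smul, smul_smul, P.ε₁_mul_self ht, one_smul]

theorem vecMulVec_areaForm_curv_eq :
    P.α.val.det ^ 2 • Matrix.vecMulVec (areaForm ℝ *ᵥ g.curv t) (areaForm ℝ *ᵥ g.curv t) =
      P.α.valᵀ * Matrix.vecMulVec (areaForm ℝ *ᵥ g'.curv (P.φ t))
        (areaForm ℝ *ᵥ g'.curv (P.φ t)) * P.α.val := by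
  have pullback : P.α.val.det • (areaForm ℝ *ᵥ g.curv t) =
      P.ε₁ t • (P.α.valᵀ *ᵥ (areaForm ℝ *ᵥ g'.curv (P.φ t))) := by
    rw [← Matrix.smul_mulVec, ← transpose_mul_areaForm_mul, ← Matrix.mulVec_mulVec,
      hP.α_mulVec_curv_eq ht, Matrix.mulVec_smul, Matrix.mulVec_mulVec]
  calc _ = Matrix.vecMulVec (P.α.val.det • (areaForm ℝ *ᵥ g.curv t))
          (P.α.val.det • (areaForm ℝ *ᵥ g.curv t)) := by
        rw [Matrix.smul_vecMulVec, Matrix.vecMulVec_smul, smul_smul, sq]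
    _ = _ := by
        rw [pullback, Matrix.smul_vecMulVec, Matrix.vecMulVec_smul, smul_smul,
          P.ε₁_mul_self ht, one_smul, Matrix.mul_vecMulVec, Matrix.vecMulVec_mul,
          Matrix.mulVec_transpose]

theorem thetaI_sq_eq : g.thetaI t ^ 2 = g'.thetaI (P.φ t) ^ 2 := by
  have hα := P.isUnit_det_α.ne_zero
  have hJ := P.jacobian_ne t ht
  have hdetH' := g'.sqrt_detH_ne_zero (P.mapsTo ht)
  have hOrbit' := g'.sqrtOrbit_ne_zero (P.mapsTo ht)
  rw [g.thetaI_eq_symDet, g'.thetaI_eq_symDet]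
  set Z := Matrix.vecMulVec (areaForm ℝ *ᵥ g.curv t) (areaForm ℝ *ᵥ g.curv t)
  set Z' := Matrix.vecMulVec (areaForm ℝ *ᵥ g'.curv (P.φ t)) (areaForm ℝ *ᵥ g'.curv (P.φ t))
  have hZ' : Z'.IsSymm := Matrix.transpose_vecMulVec _ _
  have symDet_eq : symDet (g.dhMatrix 0 t) (g.dhMatrix 1 t) Z = (jac P.φ t).det * P.α.val.det *
      symDet (g'.dhMatrix 0 (P.φ t)) (g'.dhMatrix 1 (P.φ t)) Z' := by
    apply mul_left_cancel₀ (pow_ne_zero 2 hα)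
    rw [← symDet_smul, hP.vecMulVec_areaForm_curv_eq ht, hP.dhMatrix_eq ht, hP.dhMatrix_eq ht,
      symDet_sum_smul, symDet_transpose_mul_mul _ (g'.dhMatrix_isSymm (P.mapsTo ht) 0)
        (g'.dhMatrix_isSymm (P.mapsTo ht) 1) hZ']
    ring
  rw [symDet_eq, hP.sqrt_detH_eq ht, hP.sqrtOrbit_eq ht]
  simp only [mul_pow, div_pow, sq_abs, one_pow]
  field_simp

theorem inv_eq (a : Fin 6) : g.inv a t = g'.inv a (P.φ t) := by
  fin_cases a
  · exact hP.traceInv_eq ht (hP.rho_eq ht)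
  · exact hP.traceInv_eq ht (hP.chi_eq ht)
  · exact hP.detInv_eq ht (hP.chi_eq ht)
  · exact hP.detInv_eq ht (hP.gamma_eq ht)
  · exact hP.ellC_eq ht
  · exact hP.thetaI_sq_eq ht

end Pointwise

theorem functionallyIndependentOn_image {a b : Fin 6}
    (hab : FunctionallyIndependentOn (g.inv a) (g.inv b) P.V) :
    FunctionallyIndependentOn (g'.inv a) (g'.inv b) (P.φ '' P.V) := by
  rw [functionallyIndependentOn_iff_det_jac_ne_zero] at hab ⊢
  rintro _ ⟨t, ht, rfl⟩ hdet
  have hinv' : DifferentiableAt ℝ (fun s => ![g'.inv a s, g'.inv b s]) (P.φ t) :=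
    (g'.contDiffAt_inv_pair a b (P.mapsTo ht)).differentiableAt (by simp)
  have inv_near : (fun s => ![g.inv a s, g.inv b s]) =ᶠ[𝓝 t]
      fun s => ![g'.inv a (P.φ s), g'.inv b (P.φ s)] := by
    filter_upwards [P.isOpen_V.mem_nhds ht] with s hs
    rw [hP.inv_eq hs, hP.inv_eq hs]
  refine hab t ht ?_
  rw [jac_congr inv_near, jac_comp hinv' ((P.contDiffAt_φ ht).differentiableAt (by simp)),
    Matrix.det_mul, hdet, zero_mul]

theorem condI {a b : Fin 6} (hab : FunctionallyIndependentOn (g.inv a) (g.inv b) P.V) :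
    P.CondI := by
  have hφV := hP.functionallyIndependentOn_image hab
  refine ⟨a, b, hab, hφV, fun t₀ ht₀ => ?_⟩
  have hinv' := g'.contDiffAt_inv_pair a b (P.mapsTo ht₀)
  have hdet := functionallyIndependentOn_iff_det_jac_ne_zero.1 hφV _ ⟨t₀, ht₀, rfl⟩
  obtain ⟨N, hN, hinj⟩ := exists_mem_nhds_injOn_of_injective_fderiv hinv' (by simp)
    ((injective_fderiv_iff_isUnit_det_jac (hinv'.differentiableAt (by simp))).2 hdet.isUnit)
  rw [nhds_prod_eq]
  filter_upwards [Filter.prod_mem_prod (Filter.inter_mem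
    ((P.contDiffAt_φ ht₀).continuousAt hN) (P.isOpen_V.mem_nhds ht₀)) hN]
    with ⟨t, t'⟩ ⟨⟨hφt, ht⟩, ht'⟩
  rw [hP.inv_eq ht, hP.inv_eq ht]
  constructor
  · rintro ⟨ha, hb⟩
    exact hinj ht' hφt (by simp only [ha, hb])
  · intro h
    rw [h]
    exact ⟨rfl, rfl⟩

theorem condII (hC : ∀ t ∈ P.V, g.ellC t ≠ 0) : P.CondII := by
  intro t ht
  have frame_eq : P.ε₁ t • colMatrix P.ε₂ (g'.curv (P.φ t)) (g'.curvPerp (P.φ t)) =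
      P.α.val * colMatrix 1 (g.curv t) (g.curvPerp t) := by
    rw [mul_colMatrix, hP.α_mulVec_curv_eq ht, hP.α_mulVec_curvPerp_eq ht, mul_smul,
      ← smul_colMatrix, colMatrix_smul_right, one_mul]
  rw [← Matrix.smul_mul, frame_eq, Matrix.mul_nonsing_inv_cancel_right _ _
    (g.isUnit_det_curvFrame (P.V_subset ht) (hC t ht))]

theorem condIII (hρ : ∀ t ∈ P.V, g.Crho t ≠ 0) : P.CondIII := by
  intro t ht
  have frame_eq : colMatrix (P.ε₁ t) (g'.mean (P.φ t)) (g'.meanPerp (P.φ t)) =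
      jac P.φ t * colMatrix 1 (g.mean t) (g.meanPerp t) := by
    rw [mul_colMatrix, hP.jac_mulVec_mean_eq ht, hP.jac_mulVec_meanPerp_eq ht,
      colMatrix_smul_right, one_mul]
  rw [meanQuotient, frame_eq, Matrix.mul_nonsing_inv_cancel_right _ _
    (g.isUnit_det_meanFrame (P.V_subset ht) (hρ t ht))]

theorem condIV (hρ : ∀ t ∈ P.V, g.Crho t ≠ 0) : P.CondIV := by
  have jac_ψ_eq : ∀ t ∈ P.V, jac P.ψ t = P.psiRHS t := fun t ht => by
    rw [psiRHS, hP.α_mul_fUp_eq ht, ← hP.condIII hρ t ht, add_sub_cancel_left]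
  refine ⟨fun t ht i => sub_eq_zero.1 ?_, jac_ψ_eq⟩
  have psiRHS_near : (fun s => P.psiRHS s i) =ᶠ[𝓝 t] fun s j => pd j (fun x => P.ψ x i) s := by
    filter_upwards [P.isOpen_V.mem_nhds ht] with s hs using congrFun (jac_ψ_eq s hs).symm i
  calc curl (fun s => P.psiRHS s i) t
      = curl (fun s j => pd j (fun x => P.ψ x i) s) t := curl_congr psiRHS_near
    _ = 0 := curl_gradient (contDiffAt_pi.1 ((P.contDiffAt_ψ ht).of_le (by norm_cast)) i)

end CondV

theorem CondV.conditions (hP : P.CondV) (hgen : ∀ t ∈ P.V, g.ellC t * g.Crho t ≠ 0)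
    (hind : ∃ a b : Fin 6, FunctionallyIndependentOn (g.inv a) (g.inv b) P.V) :
    P.Conditions := by
  have hC : ∀ t ∈ P.V, g.ellC t ≠ 0 := fun t ht => left_ne_zero_of_mul (hgen t ht)
  have hρ : ∀ t ∈ P.V, g.Crho t ≠ 0 := fun t ht => right_ne_zero_of_mul (hgen t ht)
  obtain ⟨a, b, hab⟩ := hind
  exact ⟨hP.condI hab, hP.condII hC, hP.condIII hρ, hP.condIV hρ, hP⟩

end AdaptedTransformation

/-! ### Lie derivatives and fibered maps -/

section LieDerivative

variable {E F G : Type*} [NormedAddCommGroup E] [NormedSpace ℝ E] [NormedAddCommGroup F]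
  [NormedSpace ℝ F] [NormedAddCommGroup G] [NormedSpace ℝ G]

/-- The Lie derivative `(L_X B)_x(v, w)` of a field of bilinear forms on a vector space. -/
def lieDerivative (B : E → E → E → G) (X : E → E) (x v w : E) : G :=
  fderiv ℝ (fun y => B y v w) x (X x) + B x (fderiv ℝ X x v) w + B x v (fderiv ℝ X x w)

theorem fderiv_clm_apply_apply {B : E → F →L[ℝ] F →L[ℝ] G} {v w : E → F} {x : E}
    (hB : DifferentiableAt ℝ B x) (hv : DifferentiableAt ℝ v x) (hw : DifferentiableAt ℝ w x)
    (u : E) :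
    fderiv ℝ (fun y => B y (v y) (w y)) x u =
      fderiv ℝ B x u (v x) (w x) + B x (fderiv ℝ v x u) (w x) + B x (v x) (fderiv ℝ w x u) := by
  rw [fderiv_clm_apply (hB.clm_apply hv) hw, fderiv_clm_apply hB hv]
  simp only [add_apply, ContinuousLinearMap.comp_apply, ContinuousLinearMap.flip_apply]
  abel

variable {Φ : E → F} {X : E → E} {Y : F → F} {x : E}

theorem fderiv_fderiv_apply_add_of_related (hΦ : ContDiffAt ℝ 2 Φ x)
    (hX : DifferentiableAt ℝ X x) (hY : DifferentiableAt ℝ Y (Φ x))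
    (hXY : ∀ᶠ y in 𝓝 x, fderiv ℝ Φ y (X y) = Y (Φ y)) (u : E) :
    fderiv ℝ (fderiv ℝ Φ) x (X x) u + fderiv ℝ Φ x (fderiv ℝ X x u) =
      fderiv ℝ Y (Φ x) (fderiv ℝ Φ x u) := by
  have hΦ' : DifferentiableAt ℝ (fderiv ℝ Φ) x :=
    (hΦ.fderiv_right (m := 1) le_rfl).differentiableAt one_ne_zero
  have hΦx : DifferentiableAt ℝ Φ x := hΦ.differentiableAt two_ne_zero
  have derivative_eq := DFunLike.congr_fun (Filter.EventuallyEq.fderiv_eq (𝕜 := ℝ) hXY) u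
  rw [fderiv_clm_apply hΦ' hX, fderiv_fun_comp x hY hΦx] at derivative_eq
  rw [hΦ.isSymmSndFDerivAt (by simp) (X x) u, ← ContinuousLinearMap.comp_apply (fderiv ℝ Y (Φ x)),
    ← derivative_eq, add_comm]
  rfl

theorem lieDerivative_pullback {A : E → E → E → G} {B : F → F →L[ℝ] F →L[ℝ] G}
    (hA : ∀ᶠ y in 𝓝 x, ∀ v w, A y v w = B (Φ y) (fderiv ℝ Φ y v) (fderiv ℝ Φ y w))
    (hB : DifferentiableAt ℝ B (Φ x)) (hΦ : ContDiffAt ℝ 2 Φ x)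
    (hX : DifferentiableAt ℝ X x) (hY : DifferentiableAt ℝ Y (Φ x))
    (hXY : ∀ᶠ y in 𝓝 x, fderiv ℝ Φ y (X y) = Y (Φ y)) (v w : E) :
    lieDerivative A X x v w =
      lieDerivative (fun y a b => B y a b) Y (Φ x) (fderiv ℝ Φ x v) (fderiv ℝ Φ x w) := by
  have hΦx : DifferentiableAt ℝ Φ x := hΦ.differentiableAt two_ne_zero
  have hΦ' : DifferentiableAt ℝ (fderiv ℝ Φ) x :=
    (hΦ.fderiv_right (m := 1) le_rfl).differentiableAt one_ne_zero
  have hΦ'_apply (u : E) : DifferentiableAt ℝ (fun y => fderiv ℝ Φ y u) x :=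
    hΦ'.clm_apply (differentiableAt_const u)
  have fderiv_hΦ'_apply (u : E) :
      fderiv ℝ (fun y => fderiv ℝ Φ y u) x (X x) = fderiv ℝ (fderiv ℝ Φ) x (X x) u := by
    simp [fderiv_clm_apply hΦ' (differentiableAt_const u)]
  have hA_near : (fun y => A y v w) =ᶠ[𝓝 x]
      fun y => B (Φ y) (fderiv ℝ Φ y v) (fderiv ℝ Φ y w) := hA.mono fun y hy => hy v w
  have fderiv_A : fderiv ℝ (fun y => A y v w) x (X x) =
      fderiv ℝ B (Φ x) (Y (Φ x)) (fderiv ℝ Φ x v) (fderiv ℝ Φ x w) +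
        B (Φ x) (fderiv ℝ (fderiv ℝ Φ) x (X x) v) (fderiv ℝ Φ x w) +
        B (Φ x) (fderiv ℝ Φ x v) (fderiv ℝ (fderiv ℝ Φ) x (X x) w) := by
    have hBΦ : DifferentiableAt ℝ (fun y => B (Φ y)) x :=
      DifferentiableAt.fun_comp' (g := B) x hB hΦx
    rw [hA_near.fderiv_eq, fderiv_clm_apply_apply hBΦ (hΦ'_apply v) (hΦ'_apply w),
      fderiv_hΦ'_apply, fderiv_hΦ'_apply, fderiv_fun_comp (g := B) x hB hΦx,
      ContinuousLinearMap.comp_apply, hXY.self_of_nhds]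
  have fderiv_B (a b : F) : fderiv ℝ (fun y => B y a b) (Φ x) (Y (Φ x)) =
      fderiv ℝ B (Φ x) (Y (Φ x)) a b := by
    simp [fderiv_clm_apply_apply hB (differentiableAt_const a) (differentiableAt_const b)]
  simp only [lieDerivative, fderiv_A, fderiv_B, hA.self_of_nhds,
    ← fderiv_fderiv_apply_add_of_related hΦ hX hY hXY, map_add, add_apply]
  abel

end LieDerivative

section FiberedMap

/-- The map `(t, z) ↦ (φ(t), L z + ψ(t))`: it covers `φ`, and its restrictions to the fibres
`t = const` differ from `L` by translations. -/
def fiberedMap {X X' Z Z' : Type*} [Add Z'] (φ : X → X') (ψ : X → Z') (L : Z → Z') (q : X × Z) :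
    X' × Z' :=
  (φ q.1, L q.2 + ψ q.1)

theorem injective_fiberedMap {X X' Z Z' : Type*} [Add Z'] [IsRightCancelAdd Z'] {φ : X → X'}
    {ψ : X → Z'} {L : Z → Z'} (hφ : Function.Injective φ) (hL : Function.Injective L) :
    Function.Injective (fiberedMap φ ψ L) := by
  rintro ⟨t, z⟩ ⟨s, y⟩ h
  obtain ⟨hts : φ t = φ s, hzy : L z + ψ t = L y + ψ s⟩ := Prod.ext_iff.1 h
  have ts_eq : t = s := hφ hts
  subst ts_eq
  exact congrArg (Prod.mk t) (hL (add_right_cancel hzy))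

theorem injective_of_injective_fiberedMap {X X' Z Z' : Type*} [AddGroup Z'] {φ : X → X'}
    {ψ : X → Z'} {L : Z → Z'} (h : Function.Injective (fiberedMap φ ψ L))
    (hL : Function.Surjective L) : Function.Injective φ := by
  intro t s hts
  obtain ⟨z, hz⟩ := hL (-ψ t)
  obtain ⟨y, hy⟩ := hL (-ψ s)
  have same_image : fiberedMap φ ψ L (t, z) = fiberedMap φ ψ L (s, y) := by
    simp only [fiberedMap, hz, hy, hts, neg_add_cancel]
  exact congrArg Prod.fst (h same_image)

variable {𝕜 E E' F F' : Type*} [NontriviallyNormedField 𝕜] [NormedAddCommGroup E]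
  [NormedSpace 𝕜 E] [NormedAddCommGroup E'] [NormedSpace 𝕜 E'] [NormedAddCommGroup F]
  [NormedSpace 𝕜 F] [NormedAddCommGroup F'] [NormedSpace 𝕜 F']
  {φ : E → E'} {ψ : E → F'} {L : F →L[𝕜] F'} {q : E × F}

theorem fderiv_fiberedMap (hφ : DifferentiableAt 𝕜 φ q.1) (hψ : DifferentiableAt 𝕜 ψ q.1) :
    ⇑(fderiv 𝕜 (fiberedMap φ ψ L) q) = fiberedMap (fderiv 𝕜 φ q.1) (fderiv 𝕜 ψ q.1) L := by
  have hφ_fst : HasFDerivAt (fun x : E × F => φ x.1) _ q :=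
    hφ.hasFDerivAt.comp q hasFDerivAt_fst
  have hψ_fst : HasFDerivAt (fun x : E × F => ψ x.1) _ q :=
    hψ.hasFDerivAt.comp q hasFDerivAt_fst
  have hL_snd : HasFDerivAt (fun x : E × F => L x.2) _ q := L.hasFDerivAt.comp q hasFDerivAt_snd
  exact congrArg DFunLike.coe (hφ_fst.prodMk (hL_snd.fun_add hψ_fst)).fderiv

theorem contDiffAt_fiberedMap {n : WithTop ℕ∞} (hφ : ContDiffAt 𝕜 n φ q.1)
    (hψ : ContDiffAt 𝕜 n ψ q.1) : ContDiffAt 𝕜 n (fiberedMap φ ψ L) q :=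
  (hφ.comp q contDiffAt_fst).prodMk
    ((L.contDiff.contDiffAt.comp q contDiffAt_snd).add (hψ.comp q contDiffAt_fst))

end FiberedMap

theorem eqOn_fiberedMap_of_fderiv_vertical {E E' F F' : Type*} [NormedAddCommGroup E]
    [NormedSpace ℝ E] [NormedAddCommGroup E'] [NormedSpace ℝ E'] [NormedAddCommGroup F]
    [NormedSpace ℝ F] [NormedAddCommGroup F'] [NormedSpace ℝ F']
    {Φ : E × F → E' × F'} {L : F →L[ℝ] F'} {S : Set E} {T : Set F} {z₀ : F}
    (hT : IsOpen T) (hTc : IsPreconnected T) (hz₀ : z₀ ∈ T)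
    (hΦ : ∀ q ∈ S ×ˢ T, DifferentiableAt ℝ Φ q)
    (hL : ∀ q ∈ S ×ˢ T, ∀ v : F, fderiv ℝ Φ q (0, v) = (0, L v)) :
    Set.EqOn Φ (fiberedMap (fun t => (Φ (t, z₀)).1) (fun t => (Φ (t, z₀)).2 - L z₀) L)
      (S ×ˢ T) := by
  rintro ⟨t, z⟩ ⟨ht : t ∈ S, hz : z ∈ T⟩
  have slice_derivative : ∀ y ∈ T,
      HasFDerivAt (fun y => Φ (t, y) - (0, L y)) (0 : F →L[ℝ] _) y := by
    intro y hy
    have hΦ_slice : HasFDerivAt (fun y => Φ (t, y)) _ y :=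
      (hΦ (t, y) ⟨ht, hy⟩).hasFDerivAt.comp y ((hasFDerivAt_const t y).prodMk (hasFDerivAt_id y))
    have hL_slice : HasFDerivAt (fun y => ((0 : E'), L y)) _ y :=
      (hasFDerivAt_const (0 : E') y).prodMk L.hasFDerivAt
    refine (hΦ_slice.fun_sub hL_slice).congr_fderiv (ContinuousLinearMap.ext fun v => ?_)
    simp [hL (t, y) ⟨ht, hy⟩ v]
  have slice_const : Φ (t, z) - (0, L z) = Φ (t, z₀) - (0, L z₀) :=
    hT.is_const_of_fderiv_eq_zero (𝕜 := ℝ) hTc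
      (fun y hy => (slice_derivative y hy).differentiableAt.differentiableWithinAt)
      (fun y hy => (slice_derivative y hy).fderiv) hz hz₀
  rw [sub_eq_iff_eq_add] at slice_const
  rw [slice_const]
  ext <;> simp [fiberedMap, add_comm]

namespace AdaptedMetric

variable (g : AdaptedMetric)

/-- The metric at the points of the leaf over `t`, as a continuous bilinear form. -/
def formAt (t : Plane) : Plane × Plane →L[ℝ] Plane × Plane →L[ℝ] ℝ :=
  (LinearMap.mk₂ ℝ (g.form (t, 0))
    (fun u v w => by simp only [form, Fin.sum_univ_two, Prod.fst_add, Prod.snd_add, Pi.add_apply]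
                     ring)
    (fun c v w => by simp only [form, Fin.sum_univ_two, Prod.smul_fst, Prod.smul_snd,
                       Pi.smul_apply, smul_eq_mul]
                     ring)
    (fun u v w => by simp only [form, Fin.sum_univ_two, Prod.fst_add, Prod.snd_add, Pi.add_apply]
                     ring)
    (fun c v w => by simp only [form, Fin.sum_univ_two, Prod.smul_fst, Prod.smul_snd,
                       Pi.smul_apply, smul_eq_mul]
                     ring)).toContinuousBilinearMap

theorem form_eq_formAt (q v w : Plane × Plane) : g.form q v w = g.formAt q.1 v w := rfl

theorem smooth_formAt : ContDiffOn ℝ ∞ g.formAt g.U := by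
  refine contDiffOn_clm_apply.2 fun v => contDiffOn_clm_apply.2 fun w => ?_
  refine ContDiffOn.add (ContDiffOn.add ?_ ?_) ?_
  · exact ContDiffOn.sum fun i _ => ContDiffOn.sum fun j _ =>
      ((g.smooth_b i j).mul contDiffOn_const).mul contDiffOn_const
  · exact ContDiffOn.sum fun i _ => ContDiffOn.sum fun k _ =>
      (g.smooth_f i k).mul contDiffOn_const
  · exact ContDiffOn.sum fun k _ => ContDiffOn.sum fun l _ =>
      ((g.smooth_h k l).mul contDiffOn_const).mul contDiffOn_const

theorem differentiableAt_formAt {t : Plane} (ht : t ∈ g.U) : DifferentiableAt ℝ g.formAt t :=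
  (g.smooth_formAt.contDiffAt (g.isOpen_U.mem_nhds ht)).differentiableAt (by simp)

theorem isKillingOn_vertical (c : Plane) : g.IsKillingOn (fun _ => (0, c)) g.domain := by
  intro q hq v w
  have hF : DifferentiableAt ℝ (fun t => g.formAt t v w) q.1 :=
    ((g.differentiableAt_formAt hq).clm_apply (differentiableAt_const v)).clm_apply
      (differentiableAt_const w)
  have hform : HasFDerivAt (fun r : Plane × Plane => g.form r v w) _ q :=
    hF.hasFDerivAt.comp q hasFDerivAt_fst
  rw [hform.fderiv]
  simp [form_eq_formAt]

theorem form_horizontal (q : Plane × Plane) (i j : Fin 2) :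
    g.form q (Pi.single i 1, 0) (Pi.single j 1, 0) = g.b q.1 i j := by
  simp [form, Pi.single_apply]

theorem form_horizontal_vertical (q : Plane × Plane) (i k : Fin 2) :
    g.form q (Pi.single i 1, 0) (0, Pi.single k 1) = g.f q.1 i k := by
  simp [form, Pi.single_apply]

theorem form_vertical (q : Plane × Plane) (k l : Fin 2) :
    g.form q (0, Pi.single k 1) (0, Pi.single l 1) = g.h q.1 k l := by
  simp [form, Pi.single_apply]

end AdaptedMetric

namespace AdaptedTransformation

variable {g g' : AdaptedMetric} (P : AdaptedTransformation g g') {q : Plane × Plane}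

theorem contDiffAt_toMap (hq : q.1 ∈ P.V) : ContDiffAt ℝ ∞ P.toMap q :=
  contDiffAt_fiberedMap (L := P.α.val.mulVecLin.toContinuousLinearMap) (P.contDiffAt_φ hq)
    (P.contDiffAt_ψ hq)

theorem fderiv_toMap_eq_fiberedMap (hq : q.1 ∈ P.V) :
    ⇑(fderiv ℝ P.toMap q) =
      fiberedMap (fderiv ℝ P.φ q.1) (fderiv ℝ P.ψ q.1) P.α.val.mulVec :=
  fderiv_fiberedMap (L := P.α.val.mulVecLin.toContinuousLinearMap)
    ((P.contDiffAt_φ hq).differentiableAt (by simp))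
    ((P.contDiffAt_ψ hq).differentiableAt (by simp))

theorem fderiv_toMap (hq : q.1 ∈ P.V) (v : Plane × Plane) :
    fderiv ℝ P.toMap q v =
      (jac P.φ q.1 *ᵥ v.1, P.α.val *ᵥ v.2 + jac P.ψ q.1 *ᵥ v.1) := by
  rw [P.fderiv_toMap_eq_fiberedMap hq, fiberedMap,
    fderiv_apply_eq_jac_mulVec ((P.contDiffAt_φ hq).differentiableAt (by simp)),
    fderiv_apply_eq_jac_mulVec ((P.contDiffAt_ψ hq).differentiableAt (by simp))]

theorem injective_fderiv_toMap (hq : q.1 ∈ P.V) : Function.Injective (fderiv ℝ P.toMap q) := by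
  rw [P.fderiv_toMap_eq_fiberedMap hq]
  exact injective_fiberedMap
    ((injective_fderiv_iff_isUnit_det_jac ((P.contDiffAt_φ hq).differentiableAt (by simp))).2
      (P.jacobian_ne _ hq).isUnit)
    (Matrix.mulVec_injective_of_isUnit P.α.isUnit)

variable {P}

theorem CondV.form_toMap (hP : P.CondV) (hq : q.1 ∈ P.V) (v w : Plane × Plane) :
    g'.form (P.toMap q) (fderiv ℝ P.toMap q v) (fderiv ℝ P.toMap q w) = g.form q v w := by
  have h_symm : g'.h (P.φ q.1) 1 0 = g'.h (P.φ q.1) 0 1 :=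
    (g'.symm_h _ (P.mapsTo hq)).apply 0 1
  obtain ⟨hb, hf, hh⟩ := hP q.1 hq
  rw [P.fderiv_toMap hq, P.fderiv_toMap hq]
  simp only [AdaptedMetric.form, toMap, hb, hf, hh, Fin.sum_univ_two, Matrix.mulVec, dotProduct,
    Pi.add_apply, h_symm]
  ring

theorem condV_of_form_toMap
    (hP : ∀ t ∈ P.V, ∃ z, ∀ v w : Plane × Plane,
      g'.form (P.toMap (t, z)) (fderiv ℝ P.toMap (t, z) v) (fderiv ℝ P.toMap (t, z) w) =
        g.form (t, z) v w) : P.CondV := by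
  intro t ht
  obtain ⟨z, hz⟩ := hP t ht
  have h_symm : g'.h (P.φ t) 1 0 = g'.h (P.φ t) 0 1 := (g'.symm_h _ (P.mapsTo ht)).apply 0 1
  have fderiv_horizontal (i : Fin 2) :
      fderiv ℝ P.toMap (t, z) (Pi.single i 1, 0) = ((jac P.φ t).col i, (jac P.ψ t).col i) := by
    simp [P.fderiv_toMap (q := (t, z)) ht]
  have fderiv_vertical (k : Fin 2) :
      fderiv ℝ P.toMap (t, z) (0, Pi.single k 1) = (0, P.α.val.col k) := by
    simp [P.fderiv_toMap (q := (t, z)) ht]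
  refine ⟨fun i j => ?_, fun i k => ?_, fun k l => ?_⟩
  · rw [← g.form_horizontal (t, z), ← hz, fderiv_horizontal, fderiv_horizontal]
    rfl
  · rw [← g.form_horizontal_vertical (t, z), ← hz, fderiv_horizontal, fderiv_vertical]
    simp only [AdaptedMetric.form, toMap, Matrix.col_apply, Fin.sum_univ_two, Pi.zero_apply,
      h_symm]
    ring
  · rw [← g.form_vertical (t, z), ← hz, fderiv_vertical, fderiv_vertical]
    simp [AdaptedMetric.form, toMap]

theorem CondV.equivalentAt (hP : P.CondV) (hq : q.1 ∈ P.V) : EquivalentAt g g' q (P.toMap q) := by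
  obtain ⟨e, he, heP⟩ := exists_openPartialHomeomorph_of_injective_fderiv (P.contDiffAt_toMap hq)
    (by simp) (P.injective_fderiv_toMap hq)
  let Φ := e.restrOpen (Prod.fst ⁻¹' P.V) (P.isOpen_V.preimage continuous_fst)
  have hΦP : ⇑Φ = P.toMap := heP
  have fst_mem : ∀ x ∈ Φ.source, x.1 ∈ P.V := fun x hx => hx.2
  have smooth_Φ : ContDiffOn ℝ ∞ Φ Φ.source := fun x hx =>
    hΦP ▸ (P.contDiffAt_toMap (fst_mem x hx)).contDiffWithinAt
  refine ⟨Φ, ⟨he, hq⟩, by rw [hΦP], fun x hx => P.V_subset (fst_mem x hx), fun y hy => ?_,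
    smooth_Φ, contDiffOn_symm_of_injective_fderiv smooth_Φ (by simp) fun x hx => ?_,
    fun x hx v w => ?_⟩
  · rw [← Φ.right_inv hy, hΦP]
    exact P.mapsTo (fst_mem _ (Φ.map_target hy))
  · rw [hΦP]
    exact P.injective_fderiv_toMap (fst_mem x hx)
  · rw [hΦP]
    exact hP.form_toMap (fst_mem x hx) v w

end AdaptedTransformation

/-! ### Local isometries -/

/-- A smooth diffeomorphism between open subsets of the domains of two metrics that pulls the
second metric back to the first. -/
structure IsLocalIsometry (g g' : AdaptedMetric)
    (Φ : OpenPartialHomeomorph (Plane × Plane) (Plane × Plane)) : Prop where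
  source_subset : Φ.source ⊆ g.domain
  target_subset : Φ.target ⊆ g'.domain
  smooth : ContDiffOn ℝ ∞ Φ Φ.source
  smooth_symm : ContDiffOn ℝ ∞ Φ.symm Φ.target
  pullback : ∀ q ∈ Φ.source, ∀ v w : Plane × Plane,
    g'.form (Φ q) (fderiv ℝ Φ q v) (fderiv ℝ Φ q w) = g.form q v w

namespace IsLocalIsometry

variable {g g' : AdaptedMetric} {Φ : OpenPartialHomeomorph (Plane × Plane) (Plane × Plane)}
  (hΦ : IsLocalIsometry g g' Φ)

include hΦ

section Pointwise

variable {q : Plane × Plane} (hq : q ∈ Φ.source)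

include hq

theorem contDiffAt : ContDiffAt ℝ ∞ Φ q := hΦ.smooth.contDiffAt (Φ.open_source.mem_nhds hq)

theorem differentiableAt : DifferentiableAt ℝ Φ q := (hΦ.contDiffAt hq).differentiableAt (by simp)

theorem differentiableAt_symm : DifferentiableAt ℝ Φ.symm (Φ q) :=
  (hΦ.smooth_symm.contDiffAt (Φ.open_target.mem_nhds (Φ.map_source hq))).differentiableAt (by simp)

theorem injective_fderiv : Function.Injective (fderiv ℝ Φ q) :=
  Function.LeftInverse.injective
    (fderiv_symm_fderiv hq (hΦ.differentiableAt hq) (hΦ.differentiableAt_symm hq))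

end Pointwise

theorem smooth_pullbackField {Y : Plane × Plane → Plane × Plane} (hY : ContDiffOn ℝ ∞ Y Φ.target) :
    ContDiffOn ℝ ∞ (fun q => fderiv ℝ Φ.symm (Φ q) (Y (Φ q))) Φ.source :=
  ((hΦ.smooth_symm.fderiv_of_isOpen Φ.open_target (m := ∞) (by simp)).clm_apply hY).comp hΦ.smooth
    Φ.mapsTo

theorem isKillingOn_pullbackField {Y : Plane × Plane → Plane × Plane}
    (hY : ContDiffOn ℝ ∞ Y Φ.target) (hKilling : g'.IsKillingOn Y Φ.target) :
    g.IsKillingOn (fun q => fderiv ℝ Φ.symm (Φ q) (Y (Φ q))) Φ.source := by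
  intro q hq v w
  have hΦq : Φ q ∈ Φ.target := Φ.map_source hq
  have formAt_fst :=
    DifferentiableAt.fun_comp' (𝕜 := ℝ) (g := g'.formAt) (f := Prod.fst) (Φ q)
      (g'.differentiableAt_formAt (hΦ.target_subset hΦq)) differentiableAt_fst
  have near_q : ∀ᶠ r in 𝓝 q, r ∈ Φ.source := Φ.open_source.mem_nhds hq
  calc lieDerivative g.form (fun r => fderiv ℝ Φ.symm (Φ r) (Y (Φ r))) q v w
      = lieDerivative g'.form Y (Φ q) (fderiv ℝ Φ q v) (fderiv ℝ Φ q w) :=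
        lieDerivative_pullback (near_q.mono fun r hr v w => (hΦ.pullback r hr v w).symm) formAt_fst
          ((hΦ.contDiffAt hq).of_le (by norm_cast))
          (((hΦ.smooth_pullbackField hY).contDiffAt near_q).differentiableAt (by simp))
          ((hY.contDiffAt (Φ.open_target.mem_nhds hΦq)).differentiableAt (by simp))
          (near_q.mono fun r hr =>
            fderiv_fderiv_symm hr (hΦ.differentiableAt hr) (hΦ.differentiableAt_symm hr) _) v w
    _ = 0 := hKilling (Φ q) hΦq _ _

theorem exists_fderiv_vertical_eq (hg : g.KillingAlgebraIsG2) {W : Set (Plane × Plane)}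
    (hW : IsOpen W) (hWc : IsPreconnected W) (hWΦ : W ⊆ Φ.source) (hne : W.Nonempty) :
    ∃ α : GL (Fin 2) ℝ, ∀ q ∈ W, ∀ v : Plane, fderiv ℝ Φ q (0, v) = (0, α.val *ᵥ v) := by
  obtain ⟨p, hp⟩ := hne
  have exists_constant (c : Plane) :
      ∃ d : Plane, ∀ q ∈ W, fderiv ℝ Φ.symm (Φ q) (0, c) = (0, d) :=
    hg W hW hWc (hWΦ.trans hΦ.source_subset) _
      ((hΦ.smooth_pullbackField contDiffOn_const).mono hWΦ)
      fun q hq => hΦ.isKillingOn_pullbackField contDiffOn_const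
        (fun y hy => g'.isKillingOn_vertical c y (hΦ.target_subset hy)) q (hWΦ hq)
  let K : Plane →ₗ[ℝ] Plane :=
    LinearMap.snd ℝ Plane Plane ∘ₗ (fderiv ℝ Φ.symm (Φ p)).toLinearMap ∘ₗ
      LinearMap.inr ℝ Plane Plane
  have fderiv_K : ∀ q ∈ W, ∀ c, fderiv ℝ Φ q (0, K c) = (0, c) := by
    intro q hq c
    obtain ⟨d, hd⟩ := exists_constant c
    have hKc : K c = d := congrArg Prod.snd (hd p hp)
    rw [hKc, ← hd q hq]
    exact fderiv_fderiv_symm (hWΦ hq) (hΦ.differentiableAt (hWΦ hq))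
      (hΦ.differentiableAt_symm (hWΦ hq)) _
  have hK : Function.Injective K := fun a b hab =>
    congrArg Prod.snd ((fderiv_K p hp a).symm.trans (hab ▸ fderiv_K p hp b))
  let e : Plane ≃ₗ[ℝ] Plane := LinearEquiv.ofInjectiveEndo K hK
  refine ⟨Matrix.GeneralLinearGroup.mkOfDetNeZero (LinearMap.toMatrix' e.symm.toLinearMap) ?_,
    fun q hq v => ?_⟩
  · rw [LinearMap.det_toMatrix']
    exact e.symm.isUnit_det'.ne_zero
  · obtain ⟨c, rfl⟩ := e.surjective v
    change _ = (0, LinearMap.toMatrix' e.symm.toLinearMap *ᵥ e c)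
    rw [LinearMap.toMatrix'_mulVec, LinearEquiv.coe_coe, e.symm_apply_apply]
    exact fderiv_K q hq c

end IsLocalIsometry

namespace IsLocalIsometry

variable {g g' : AdaptedMetric} {Φ : OpenPartialHomeomorph (Plane × Plane) (Plane × Plane)}
  (hΦ : IsLocalIsometry g g' Φ) {p : Plane × Plane}

include hΦ

theorem exists_eqOn_fiberedMap (hg : g.KillingAlgebraIsG2) (hp : p ∈ Φ.source) :
    ∃ (V T : Set Plane) (φ ψ : Plane → Plane) (α : GL (Fin 2) ℝ),
      IsOpen V ∧ IsOpen T ∧ p ∈ V ×ˢ T ∧ V ×ˢ T ⊆ Φ.source ∧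
        ContDiffOn ℝ ∞ φ V ∧ ContDiffOn ℝ ∞ ψ V ∧
        Set.EqOn Φ (fiberedMap φ ψ α.val.mulVec) (V ×ˢ T) := by
  obtain ⟨r, hr, ball_subset⟩ := Metric.isOpen_iff.1 Φ.open_source p hp
  obtain ⟨α, hα⟩ := hΦ.exists_fderiv_vertical_eq hg Metric.isOpen_ball
    (convex_ball p r).isPreconnected ball_subset ⟨p, Metric.mem_ball_self hr⟩
  rw [← ball_prod_same] at ball_subset hα
  have hp₁ : p.1 ∈ Metric.ball p.1 r := Metric.mem_ball_self hr
  have hp₂ : p.2 ∈ Metric.ball p.2 r := Metric.mem_ball_self hr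
  have smooth_slice : ContDiffOn ℝ ∞ (fun t => Φ (t, p.2)) (Metric.ball p.1 r) :=
    hΦ.smooth.comp (contDiffOn_id.prodMk contDiffOn_const) fun t ht => ball_subset ⟨ht, hp₂⟩
  exact ⟨Metric.ball p.1 r, Metric.ball p.2 r, _, _, α, Metric.isOpen_ball, Metric.isOpen_ball,
    ⟨hp₁, hp₂⟩, ball_subset, smooth_slice.fst, smooth_slice.snd.sub contDiffOn_const,
    eqOn_fiberedMap_of_fderiv_vertical (L := α.val.mulVecLin.toContinuousLinearMap)
      Metric.isOpen_ball (convex_ball p.2 r).isPreconnected hp₂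
      (fun q hq => hΦ.differentiableAt (ball_subset hq)) hα⟩

theorem isUnit_det_jac_of_eventuallyEq_fiberedMap {φ ψ : Plane → Plane} {α : GL (Fin 2) ℝ}
    (hp : p ∈ Φ.source) (hφ : DifferentiableAt ℝ φ p.1) (hψ : DifferentiableAt ℝ ψ p.1)
    (hΦφ : Φ =ᶠ[𝓝 p] fiberedMap φ ψ α.val.mulVec) : IsUnit (jac φ p.1).det := by
  have fderiv_eq : ⇑(fderiv ℝ Φ p) =
      fiberedMap (fderiv ℝ φ p.1) (fderiv ℝ ψ p.1) α.val.mulVec := by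
    rw [hΦφ.fderiv_eq]
    exact fderiv_fiberedMap (L := α.val.mulVecLin.toContinuousLinearMap) hφ hψ
  rw [← injective_fderiv_iff_isUnit_det_jac hφ]
  exact injective_of_injective_fiberedMap (fderiv_eq ▸ hΦ.injective_fderiv hp)
    (Matrix.mulVec_surjective_iff_isUnit.2 α.isUnit)

theorem exists_adaptedTransformation_eventuallyEq (hg : g.KillingAlgebraIsG2)
    (hp : p ∈ Φ.source) :
    ∃ P : AdaptedTransformation g g', p.1 ∈ P.V ∧
      ∀ t ∈ P.V, (t, p.2) ∈ Φ.source ∧ Φ =ᶠ[𝓝 (t, p.2)] P.toMap := by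
  obtain ⟨V, T, φ, ψ, α, hV, hT, ⟨hpV, hpT⟩, hVT, hφ, hψ, hΦφ⟩ :=
    hΦ.exists_eqOn_fiberedMap hg hp
  have mem_source : ∀ t ∈ V, (t, p.2) ∈ Φ.source := fun t ht => hVT ⟨ht, hpT⟩
  have near_leaf : ∀ t ∈ V, Φ =ᶠ[𝓝 (t, p.2)] fiberedMap φ ψ α.val.mulVec := fun t ht =>
    hΦφ.eventuallyEq_of_mem ((hV.prod hT).mem_nhds ⟨ht, hpT⟩)
  have hφ_at : ∀ t ∈ V, ContDiffAt ℝ ∞ φ t := fun t ht => hφ.contDiffAt (hV.mem_nhds ht)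
  have hφd : ∀ t ∈ V, DifferentiableAt ℝ φ t := fun t ht => (hφ_at t ht).differentiableAt (by simp)
  have hψd : ∀ t ∈ V, DifferentiableAt ℝ ψ t := fun t ht =>
    (hψ.contDiffAt (hV.mem_nhds ht)).differentiableAt (by simp)
  have isUnit_jac : ∀ t ∈ V, IsUnit (jac φ t).det := fun t ht =>
    hΦ.isUnit_det_jac_of_eventuallyEq_fiberedMap (p := (t, p.2)) (mem_source t ht) (hφd t ht)
      (hψd t ht) (near_leaf t ht)
  have mapsTo : Set.MapsTo φ V g'.U := fun t ht => by
    have hφt : (Φ (t, p.2)).1 = φ t := congrArg Prod.fst (near_leaf t ht).eq_of_nhds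
    rw [← hφt]
    exact hΦ.target_subset (Φ.map_source (mem_source t ht))
  obtain ⟨N, hN, hφN⟩ := exists_mem_nhds_injOn_of_injective_fderiv (hφ_at p.1 hpV) (by simp)
    ((injective_fderiv_iff_isUnit_det_jac (hφd p.1 hpV)).2 (isUnit_jac p.1 hpV))
  exact ⟨{
      V := V ∩ interior N
      isOpen_V := hV.inter isOpen_interior
      V_subset := fun t ht => hΦ.source_subset (mem_source t ht.1)
      φ := φ
      ψ := ψ
      α := α
      smooth_φ := hφ.mono Set.inter_subset_left
      smooth_ψ := hψ.mono Set.inter_subset_left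
      mapsTo := mapsTo.mono_left Set.inter_subset_left
      injOn := hφN.mono (Set.inter_subset_right.trans interior_subset)
      jacobian_ne := fun t ht => (isUnit_jac t ht.1).ne_zero },
    ⟨hpV, mem_interior_iff_mem_nhds.2 hN⟩,
    fun t ht => ⟨mem_source t ht.1, near_leaf t ht.1⟩⟩

theorem exists_adaptedTransformation (hg : g.KillingAlgebraIsG2) (hp : p ∈ Φ.source) :
    ∃ P : AdaptedTransformation g g', p.1 ∈ P.V ∧ P.toMap p = Φ p ∧ P.CondV := by
  obtain ⟨P, hpV, hP⟩ := hΦ.exists_adaptedTransformation_eventuallyEq hg hp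
  refine ⟨P, hpV, (hP p.1 hpV).2.eq_of_nhds.symm,
    AdaptedTransformation.condV_of_form_toMap fun t ht => ⟨p.2, fun v w => ?_⟩⟩
  obtain ⟨mem_source, eventuallyEq⟩ := hP t ht
  rw [← eventuallyEq.eq_of_nhds, ← eventuallyEq.fderiv_eq]
  exact hΦ.pullback _ mem_source v w

end IsLocalIsometry

theorem equivalentAt_iff {g g' : AdaptedMetric} (hg : g.KillingAlgebraIsG2)
    (hgen : ∀ t ∈ g.U, g.ellC t * g.Crho t ≠ 0)
    (hind : ∃ a b : Fin 6, FunctionallyIndependentOn (g.inv a) (g.inv b) g.U)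
    {p p' : Plane × Plane} :
    EquivalentAt g g' p p' ↔
      ∃ P : AdaptedTransformation g g', p.1 ∈ P.V ∧ P.toMap p = p' ∧ P.Conditions := by
  constructor
  · rintro ⟨Φ, hp, rfl, source_subset, target_subset, smooth, smooth_symm, pullback⟩
    have hΦ : IsLocalIsometry g g' Φ :=
      ⟨source_subset, target_subset, smooth, smooth_symm, pullback⟩
    obtain ⟨P, hpV, hPp, hP⟩ := hΦ.exists_adaptedTransformation hg hp
    obtain ⟨a, b, hab⟩ := hind
    exact ⟨P, hpV, hPp, hP.conditions (fun t ht => hgen t (P.V_subset ht))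
      ⟨a, b, fun t ht => hab t (P.V_subset ht)⟩⟩
  · rintro ⟨P, hp, rfl, hP⟩
    exact AdaptedTransformation.CondV.equivalentAt hP.2.2.2.2 hp

end

theorem mainTheorem3_general (g g' : AdaptedMetric) (hg : g.KillingAlgebraIsG2)
    (hgen : ∀ t ∈ g.U, g.ellC t * g.Crho t ≠ 0)
    (hind : ∃ a b : Fin 6, FunctionallyIndependentOn (g.inv a) (g.inv b) g.U) :
    (Equivalent g g' ↔
      ∃ P : AdaptedTransformation g g', P.V.Nonempty ∧ P.Conditions) ∧
    ∀ p p' : Plane × Plane,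
      (EquivalentAt g g' p p' ↔
        ∃ P : AdaptedTransformation g g', p.1 ∈ P.V ∧ P.toMap p = p' ∧ P.Conditions) := by
  have pointwise (p p' : Plane × Plane) :
      EquivalentAt g g' p p' ↔
        ∃ P : AdaptedTransformation g g', p.1 ∈ P.V ∧ P.toMap p = p' ∧ P.Conditions :=
    equivalentAt_iff hg hgen hind
  refine ⟨⟨?_, ?_⟩, pointwise⟩
  · rintro ⟨p, _, p', _, h⟩
    obtain ⟨P, hp, _, hP⟩ := (pointwise p p').1 h
    exact ⟨P, ⟨p.1, hp⟩, hP⟩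
  · rintro ⟨P, ⟨t, ht⟩, hP⟩
    exact ⟨(t, 0), P.V_subset ht, P.toMap (t, 0), P.mapsTo ht,
      (pointwise _ _).2 ⟨P, ht, rfl, hP⟩⟩

theorem mainTheorem3 (g g' : AdaptedMetric)
    (hg : g.KillingAlgebraIsG2) (hg' : g'.KillingAlgebraIsG2)
    (hgen : ∀ t ∈ g.U, g.ellC t * g.Crho t ≠ 0)
    (hgen' : ∀ t ∈ g'.U, g'.ellC t * g'.Crho t ≠ 0)
    (hind : ∃ a b : Fin 6, FunctionallyIndependentOn (g.inv a) (g.inv b) g.U) :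
    (Equivalent g g' ↔
      ∃ P : AdaptedTransformation g g', P.V.Nonempty ∧ P.Conditions) ∧
    ∀ p ∈ g.domain, ∀ p' ∈ g'.domain,
      (EquivalentAt g g' p p' ↔
        ∃ P : AdaptedTransformation g g', p.1 ∈ P.V ∧ P.toMap p = p' ∧ P.Conditions) :=
  let ⟨equivalent_iff, pointwise⟩ := mainTheorem3_general g g' hg hgen hind
  ⟨equivalent_iff, fun p _ p' _ => pointwise p p'⟩
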